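/- **Notation.** Fix $g,\ell\in\mathbb N$. Let $\mathbb R\langle x,x^*\rangle$ be the free real algebra on the letters $x_1,\dots,x_g,x_1^*,\dots,x_g^*$, with the linear involution $*$ that swaps $x_i$ and $x_i^*$ and reverses products; on matrices $p=\sum_w A_w\otimes w$ of polynomials put $p^*=\sum_w A_w^{T}\otimes w^*$. For a tuple $X\in(\mathbb R^{n\times n})^g$ let $p(X)=\sum_w A_w\otimes w(X)$, where $x_i\mapsto X_i$ and $x_i^*\mapsto X_i^{T}$. For $p\in\mathbb R^{\ell\times\ell}\langle x,x^*\rangle$ let $\mathcal D_p(n)=\{X\in(\mathbb R^{n\times n})^g: p(X)\succeq0\}$, where $\succeq 0$ means symmetric positive semidefinite; let $\mathcal D_p^\circ(n)$ be the connected component of $0$ in $\{X\in(\mathbb R^{n\times n})^g:p(X)\succ0\}$ (empty if $p(0)\not\succ0$); and let $$\widehat{\partial\mathcal D}{}^\circ_p(n)=\{(X,v)\in(\mathbb R^{n\times n})^g\times\mathbb R^{\ell n}:X\in\overline{\mathcal D_p^\circ(n)},\ p(X)v=0\}.$$ Dropping $n$ denotes the union over all $n\in\mathbb N$; closures are taken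 in each level $n$. A monic linear pencil is $L=\mathrm{Id}_\ell+\sum_{i=1}^g(A_i\otimes x_i+A_i^{T}\otimes x_i^*)$ with $A_i\in\mathbb R^{\ell\times\ell}$. It has the *zero determining property* if the set of all $(X,v)$ that are annihilated ($f(X)v=0$) by every row $f\in\mathbb R^{1\times\ell}\langle x,x^*\rangle$ vanishing on $\widehat{\partial\mathcal D}{}^\circ_L$ equals $\{(X,v):L(X)v=0\}$. **Theorem (Randstellensatz).** Let $L\in\mathbb R^{\ell\times\ell}\langle x,x^*\rangle$ be a monic linear pencil with the zero determining property and let $p\in\mathbb R^{\ell\times\ell}\langle x,x^*\rangle$. Consider the representation $$p=L\Big(\sum_i^{\rm finite}q_i^*q_i\Big)L+\sum_j^{\rm finite}(r_jL+C_j)^*L(r_jL+C_j)\tag{R}$$ with $q_i\in\mathbb R^{1\times\ell}\langle x,x^*\rangle$, $r_j\in\mathbb R^{\ell\times\ell}\langle x,x^*\rangle$ and $C_j\in\mathbb R^{\ell\times\ell}$ such that $C_jL=LC_j$. 1. $\mathcal D_L\subseteq\mathcal D_p$ and $p(X)v=0$ for all $(X,v)\in\widehat{\partial\mathcal D}{}^\circ_L$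 if and only if $p$ has a representation (R). 2. $\mathcal D_L\subseteq\mathcal D_p$ and $\widehat{\partial\mathcal D}{}^\circ_L\subseteq\widehat{\partial\mathcal D}{}^\circ_p$ if and only if $p$ has a representation (R) and $\mathcal D_L^\circ(n)\subseteq\overline{\mathcal D_p^\circ(n)}$ for every $n$. -/

import Mathlib

open scoped Matrix

/-- The free algebra `ℝ⟨x, x*⟩` in the `2g` letters `x₁, …, x_g, x₁*, …, x_g*`:
`Sum.inl i` stands for `x_i` and `Sum.inr i` for `x_i*`. (A new name is used because Mathlib's
involution on `FreeAlgebra` fixes every letter.) -/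
def NCPoly (g : ℕ) : Type := FreeAlgebra ℝ (Fin g ⊕ Fin g)

namespace NCPoly

variable {g : ℕ}

noncomputable instance : Ring (NCPoly g) :=
  inferInstanceAs (Ring (FreeAlgebra ℝ (Fin g ⊕ Fin g)))

noncomputable instance : Algebra ℝ (NCPoly g) :=
  inferInstanceAs (Algebra ℝ (FreeAlgebra ℝ (Fin g ⊕ Fin g)))

/-- A letter, as a polynomial. -/
noncomputable def letter (a : Fin g ⊕ Fin g) : NCPoly g := FreeAlgebra.ι ℝ a

/-- The variable `x_i`. -/
noncomputable def x (i : Fin g) : NCPoly g := letter (Sum.inl i)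

/-- The variable `x_i*`. -/
noncomputable def xs (i : Fin g) : NCPoly g := letter (Sum.inr i)

/-- The universal property of `ℝ⟨x, x*⟩`. -/
noncomputable def lift {B : Type*} [Ring B] [Algebra ℝ B] (f : Fin g ⊕ Fin g → B) :
    NCPoly g →ₐ[ℝ] B :=
  FreeAlgebra.lift ℝ f

@[simp] theorem lift_letter {B : Type*} [Ring B] [Algebra ℝ B] (f : Fin g ⊕ Fin g → B)
    (a : Fin g ⊕ Fin g) : lift f (letter a) = f a :=
  FreeAlgebra.lift_ι_apply f a

theorem hom_ext {B : Type*} [Ring B] [Algebra ℝ B] {f₁ f₂ : NCPoly g →ₐ[ℝ] B}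
    (h : ∀ a, f₁ (letter a) = f₂ (letter a)) : f₁ = f₂ :=
  FreeAlgebra.hom_ext (funext h)

/-- The involution, as an `ℝ`-algebra homomorphism to the opposite algebra:
it swaps `x_i` and `x_i*`. -/
noncomputable def starHom : NCPoly g →ₐ[ℝ] (NCPoly g)ᵐᵒᵖ :=
  lift fun a => MulOpposite.op (letter a.swap)

theorem starHom_starHom (p : NCPoly g) : (starHom (starHom p).unop).unop = p := by
  have h2 : (AlgHom.opComm (starHom (g := g))).comp starHom = AlgHom.id ℝ (NCPoly g) := by
    apply hom_ext
    intro a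
    simp [starHom, AlgHom.opComm]
  exact DFunLike.congr_fun h2 p

/-- The involution on `ℝ⟨x, x*⟩`: it is linear, reverses products and swaps `x_i` and `x_i*`. -/
noncomputable instance : StarRing (NCPoly g) where
  star p := (starHom p).unop
  star_involutive := starHom_starHom
  star_mul p q := by simp
  star_add p q := by simp

theorem star_def (p : NCPoly g) : star p = (starHom p).unop := rfl

@[simp] theorem star_x (i : Fin g) : star (x i) = xs i := by
  simp [star_def, starHom, x, xs]

@[simp] theorem star_xs (i : Fin g) : star (xs i) = x i := by
  simp [star_def, starHom, x, xs]

@[simp] theorem star_algebraMap (c : ℝ) :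
    star (algebraMap ℝ (NCPoly g) c) = algebraMap ℝ (NCPoly g) c := by
  simp [star_def]

end NCPoly

/-- `(ℝ^{n×n})^g`, the tuples of `g` real `n × n` matrices. -/
abbrev MatTuple (g n : ℕ) : Type := Fin g → Matrix (Fin n) (Fin n) ℝ

/-- The `ν × ℓ` matrices over `ℝ⟨x, x*⟩`. The involution `p ↦ p*` on them is the conjugate
transpose `pᴴ`, i.e. the transpose with the involution applied to every entry. -/
abbrev NCMat (g ν ℓ : ℕ) : Type := Matrix (Fin ν) (Fin ℓ) (NCPoly g)

/-- The simple tensor `A ⊗ a` of a real matrix and a polynomial. -/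
noncomputable def tens {g ν ℓ : ℕ} (A : Matrix (Fin ν) (Fin ℓ) ℝ) (a : NCPoly g) : NCMat g ν ℓ :=
  A.map fun c => c • a

/-- A constant matrix, as a matrix of polynomials. -/
noncomputable def constMat {g ν ℓ : ℕ} (C : Matrix (Fin ν) (Fin ℓ) ℝ) : NCMat g ν ℓ :=
  C.map (algebraMap ℝ (NCPoly g))

/-- Evaluation of a polynomial at `X`: `x_i ↦ X_i`, `x_i* ↦ X_iᵀ`, `1 ↦ Id_n`. -/
noncomputable def evalPoly {g n : ℕ} (X : MatTuple g n) :
    NCPoly g →ₐ[ℝ] Matrix (Fin n) (Fin n) ℝ :=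
  NCPoly.lift (Sum.elim X fun i => (X i)ᵀ)

/-- Evaluation of a matrix of polynomials, `(∑ A_w ⊗ w)(X) = ∑ A_w ⊗ w(X)`: the block matrix
whose `(i, j)` block is `p_{ij}(X)`. -/
noncomputable def evalMat {g ν ℓ n : ℕ} (p : NCMat g ν ℓ) (X : MatTuple g n) :
    Matrix (Fin ν × Fin n) (Fin ℓ × Fin n) ℝ :=
  Matrix.of fun a b => evalPoly X (p a.1 b.1) a.2 b.2

/-- The evaluation of a simple tensor is the Kronecker product. -/
theorem evalMat_tens {g ν ℓ n : ℕ} (A : Matrix (Fin ν) (Fin ℓ) ℝ) (a : NCPoly g)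
    (X : MatTuple g n) :
    evalMat (tens A a) X = Matrix.kroneckerMap (· * ·) A (evalPoly X a) := by
  ext i j
  simp [evalMat, tens, Matrix.kroneckerMap]

/-- `L` is a monic linear pencil:
`L = Id + ∑ A_i ⊗ x_i + ∑ A_i* ⊗ x_i*` with real matrices `A_i`. -/
def IsMonicLinearPencil {g ℓ : ℕ} (L : NCMat g ℓ ℓ) : Prop :=
  ∃ A : Fin g → Matrix (Fin ℓ) (Fin ℓ) ℝ,
    L = 1 + ∑ i, tens (A i) (NCPoly.x i) + ∑ i, tens (A i)ᵀ (NCPoly.xs i)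

/-- The positivity domain at level `n`: `𝒟_p(n) = {X | p(X) ⪰ 0}`. -/
def posDomain {g ℓ : ℕ} (p : NCMat g ℓ ℓ) (n : ℕ) : Set (MatTuple g n) :=
  {X | (evalMat p X).PosSemidef}

/-- `𝒟_p(n)°`: the connected component of `0` in `{X | p(X) ≻ 0}`
(it is empty if `p(0)` is not positive definite). -/
def principalComponent {g ℓ : ℕ} (p : NCMat g ℓ ℓ) (n : ℕ) : Set (MatTuple g n) :=
  connectedComponentIn {X | (evalMat p X).PosDef} 0

/-- A set of pairs `(X, v)`, `X ∈ (ℝ^{n×n})^g`, `v ∈ ℝ^{ℓn}`, with `n` ranging over `ℕ`,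
given by its levels. -/
abbrev PairSet (g ℓ : ℕ) : Type := ∀ n : ℕ, Set (MatTuple g n × (Fin ℓ × Fin n → ℝ))

/-- The detailed boundary: all `(X, v)` with `X` in the closure of `𝒟_p°` and `p(X)v = 0`. -/
def detailedBoundary {g ℓ : ℕ} (p : NCMat g ℓ ℓ) : PairSet g ℓ := fun n =>
  {Xv | Xv.1 ∈ closure (principalComponent p n) ∧ (evalMat p Xv.1).mulVec Xv.2 = 0}

/-- `{(X, v) | p(X)v = 0}` for a matrix `p` of polynomials. -/
def matZeroSet {g ν ℓ : ℕ} (p : NCMat g ν ℓ) : PairSet g ℓ := fun _ =>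
  {Xv | (evalMat p Xv.1).mulVec Xv.2 = 0}

/-- `V(S)`, the common zeros of a set `S` of rows of polynomials. -/
def zeroSet {g ℓ : ℕ} (S : Set (NCMat g 1 ℓ)) : PairSet g ℓ := fun _ =>
  {Xv | ∀ p ∈ S, (evalMat p Xv.1).mulVec Xv.2 = 0}

/-- `ℐ(W)`, the rows of polynomials that vanish on `W`. -/
def vanishingModule {g ℓ : ℕ} (W : PairSet g ℓ) : Set (NCMat g 1 ℓ) :=
  {p | ∀ n, ∀ Xv ∈ W n, (evalMat p Xv.1).mulVec Xv.2 = 0}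

/-- The free Zariski closure `𝒵(W) = V(ℐ(W))`. -/
def freeZariskiClosure {g ℓ : ℕ} (W : PairSet g ℓ) : PairSet g ℓ :=
  zeroSet (vanishingModule W)

/-- The zero determining property: the free Zariski closure of the detailed boundary of `L`
is `{(X, v) | L(X)v = 0}`. -/
def ZeroDetermining {g ℓ : ℕ} (L : NCMat g ℓ ℓ) : Prop :=
  freeZariskiClosure (detailedBoundary L) = matZeroSet L

/-- `p = L (∑ q_i* q_i) L + ∑ (r_j L + C_j)* L (r_j L + C_j)` (finite sums) with rows `q_i` and
square matrices `r_j` of polynomials, and constant matrices `C_j` that commute with `L`. -/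
def HasRandRepresentation {g ℓ : ℕ} (L p : NCMat g ℓ ℓ) : Prop :=
  ∃ (M N : ℕ) (q : Fin M → NCMat g 1 ℓ) (r : Fin N → NCMat g ℓ ℓ)
    (C : Fin N → Matrix (Fin ℓ) (Fin ℓ) ℝ),
    (∀ j, constMat (C j) * L = L * constMat (C j)) ∧
    p = L * (∑ i, (q i)ᴴ * q i) * L +
      ∑ j, (r j * L + constMat (C j))ᴴ * L * (r j * L + constMat (C j))

/-! The argument combines a Positivstellensatz with two algebraic statements about the zeros of `L`.

Positivity on `𝒟_L` alone yields `p = ∑ q_i* q_i + ∑ U_i* L U_i` (`exists_sum_of_squares`).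
Otherwise a functional separates `p` from the truncated quadratic module, whose closedness comes
from a strictly positive functional. After symmetrization and a small perturbation, a GNS
construction turns it into a tuple `X` with `L(X) ⪰ 0` and a vector at which `p(X)` is negative.

At a boundary pair, `p(X)v = 0` and `L(X) ⪰ 0` force every term to vanish, so `q_i(X)v = 0` and
`L(X)U_i(X)v = 0` (`terms_vanish`). The zero determining property extends these equations to all
zeros of `L`. It remains to show that a row vanishing on the zeros of `L` is a left multiple of `L`
(`exists_eq_mul_pencil`), and that a matrix `U` preserving the zeros of `L` has the form `rL + C`
with `C` commuting with `L` (`exists_eq_mul_pencil_add_constMat`).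

Both are proved on one explicit family of zeros. The vectors are the columns of the stacked
coefficients `A_a`; the letters act on them so as to cancel the identity term of `L`, and also send
them to multiples `β_a` of the vacuum of a truncated Fock space, where `∑ A_a β_a = 0`. Applying a
polynomial to such a zero exposes its leading coefficients as Fock components. Their vanishing for
all `β` says that the leading coefficients lie in the row space of `(A_a)_a`, which allows division
by `L` and induction on the degree. -/

/-! ### Words, degree and right division in the free algebra -/

namespace NCPoly

variable {g : ℕ}

/-- The monomial of a word in the letters. -/
noncomputable def word (w : List (Fin g ⊕ Fin g)) : NCPoly g := (w.map letter).prod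

@[simp] theorem word_nil : word ([] : List (Fin g ⊕ Fin g)) = 1 := rfl

@[simp] theorem word_cons (a : Fin g ⊕ Fin g) (w : List (Fin g ⊕ Fin g)) :
    word (a :: w) = letter a * word w := by simp [word]

theorem word_append (u w : List (Fin g ⊕ Fin g)) : word (u ++ w) = word u * word w := by
  simp [word]

/-- The basis of words. -/
noncomputable def wordBasis (g : ℕ) : Module.Basis (List (Fin g ⊕ Fin g)) ℝ (NCPoly g) :=
  (FreeAlgebra.basisFreeMonoid ℝ (Fin g ⊕ Fin g)).reindex FreeMonoid.toList

@[simp] theorem wordBasis_apply (w : List (Fin g ⊕ Fin g)) : wordBasis g w = word w := by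
  have h : ∀ w : List (Fin g ⊕ Fin g),
      FreeAlgebra.basisFreeMonoid ℝ (Fin g ⊕ Fin g) (FreeMonoid.ofList w) =
        (w.map (FreeAlgebra.ι ℝ)).prod := by
    intro w
    simp only [FreeAlgebra.basisFreeMonoid, Module.Basis.map_apply, Finsupp.coe_basisSingleOne]
    apply FreeAlgebra.equivMonoidAlgebraFreeMonoid.injective
    simp only [LinearEquiv.trans_symm, LinearEquiv.trans_apply]
    erw [AlgEquiv.apply_symm_apply]
    induction w with
    | nil => simp; rfl
    | cons a w ih =>
      rw [List.map_cons, List.prod_cons, map_mul, ← ih, FreeMonoid.ofList_cons]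
      simp [FreeAlgebra.equivMonoidAlgebraFreeMonoid]
  exact ((FreeAlgebra.basisFreeMonoid ℝ (Fin g ⊕ Fin g)).reindex_apply FreeMonoid.toList w).trans (h w)

/-- The coefficient of a word. -/
noncomputable def coeff (w : List (Fin g ⊕ Fin g)) : NCPoly g →ₗ[ℝ] ℝ := (wordBasis g).coord w

theorem coeff_word [DecidableEq (List (Fin g ⊕ Fin g))] (u w : List (Fin g ⊕ Fin g)) :
    coeff u (word w) = if w = u then 1 else 0 := by
  classical
  rw [coeff, ← wordBasis_apply, Module.Basis.coord_apply, Module.Basis.repr_self,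
    Finsupp.single_apply]

theorem span_word : Submodule.span ℝ (Set.range (word (g := g))) = ⊤ := by
  rw [← (wordBasis g).span_eq]
  congr 1
  ext
  simp

/-- Linear maps agreeing on words are equal. -/
theorem linearMap_ext {M : Type*} [AddCommMonoid M] [Module ℝ M] {φ ψ : NCPoly g →ₗ[ℝ] M}
    (h : ∀ w, φ (word w) = ψ (word w)) : φ = ψ :=
  (wordBasis g).ext fun w => by simpa using h w

theorem eq_of_coeff {p q : NCPoly g} (h : ∀ w, coeff w p = coeff w q) : p = q :=
  (wordBasis g).ext_elem h

/-- The polynomials of degree less than `d`. -/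
noncomputable def degLT (g d : ℕ) : Submodule ℝ (NCPoly g) where
  carrier := {p | ∀ w : List (Fin g ⊕ Fin g), d ≤ w.length → coeff w p = 0}
  add_mem' hp hq w hw := by simp [hp w hw, hq w hw]
  zero_mem' := by simp
  smul_mem' c p hp w hw := by simp [hp w hw]

theorem degLT_mono {d e : ℕ} (h : d ≤ e) : degLT g d ≤ degLT g e :=
  fun _ hp w hw => hp w (h.trans hw)

theorem degLT_zero {p : NCPoly g} (hp : p ∈ degLT g 0) : p = 0 :=
  eq_of_coeff fun w => by simp [hp w (Nat.zero_le _)]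

theorem degLT_of_top {d : ℕ} {p : NCPoly g} (hp : p ∈ degLT g (d + 1))
    (h : ∀ w : List (Fin g ⊕ Fin g), w.length = d → coeff w p = 0) : p ∈ degLT g d := by
  intro w hw
  rcases hw.eq_or_lt with h' | h'
  · exact h w h'.symm
  · exact hp w h'

theorem word_mem_degLT {d : ℕ} {w : List (Fin g ⊕ Fin g)} (h : w.length < d) :
    word w ∈ degLT g d := by
  classical
  intro u hu
  rw [coeff_word, if_neg]
  rintro rfl
  omega

theorem degLT_eq_span (d : ℕ) : degLT g d = Submodule.span ℝ (word '' {w | w.length < d}) := by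
  apply le_antisymm
  · intro p hp
    have : (word : List (Fin g ⊕ Fin g) → NCPoly g) = wordBasis g := by ext; simp
    rw [this, Module.Basis.mem_span_image]
    intro w hw
    by_contra hlt
    exact (Finsupp.mem_support_iff.1 hw) (hp w (not_lt.1 hlt))
  · rw [Submodule.span_le]
    rintro _ ⟨w, hw, rfl⟩
    exact word_mem_degLT hw

instance (d : ℕ) : FiniteDimensional ℝ (degLT g d) := by
  rw [degLT_eq_span]
  exact FiniteDimensional.span_of_finite ℝ ((List.finite_length_lt _ d).image _)

theorem exists_mem_degLT (p : NCPoly g) : ∃ d, p ∈ degLT g d := by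
  have hp : p ∈ Submodule.span ℝ (Set.range (word (g := g))) := by rw [span_word]; trivial
  induction hp using Submodule.span_induction with
  | mem x hx =>
    obtain ⟨w, rfl⟩ := hx
    exact ⟨_, word_mem_degLT (Nat.lt_succ_self _)⟩
  | zero => exact ⟨0, Submodule.zero_mem _⟩
  | add x y _ _ hx hy =>
    obtain ⟨d, hd⟩ := hx
    obtain ⟨e, he⟩ := hy
    exact ⟨max d e, Submodule.add_mem _ (degLT_mono (le_max_left _ _) hd)
      (degLT_mono (le_max_right _ _) he)⟩
  | smul c x _ hx =>
    obtain ⟨d, hd⟩ := hx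
    exact ⟨d, Submodule.smul_mem _ _ hd⟩

theorem exists_forall_mem_degLT {ι : Type*} [Finite ι] (p : ι → NCPoly g) :
    ∃ d, ∀ i, p i ∈ degLT g d := by
  classical
  cases nonempty_fintype ι
  choose d hd using fun i => exists_mem_degLT (p i)
  exact ⟨Finset.univ.sup d, fun i => degLT_mono (Finset.le_sup (Finset.mem_univ i)) (hd i)⟩

theorem one_mem_degLT (d : ℕ) : (1 : NCPoly g) ∈ degLT g (d + 1) := by
  simpa using word_mem_degLT (w := ([] : List (Fin g ⊕ Fin g))) (Nat.succ_pos d)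

theorem coeff_mul_letter_append (p : NCPoly g) (w : List (Fin g ⊕ Fin g)) (a b : Fin g ⊕ Fin g) :
    coeff (w ++ [b]) (p * letter a) = if a = b then coeff w p else 0 := by
  classical
  have : (coeff (w ++ [b])).comp (LinearMap.mulRight ℝ (letter a)) =
      (if a = b then coeff w else 0) := by
    apply linearMap_ext
    intro u
    have : word u * letter a = word (u ++ [a]) := by simp [word_append]
    simp only [LinearMap.comp_apply, LinearMap.mulRight_apply, this, coeff_word]
    split_ifs with h1 h2 h2 <;> simp_all [coeff_word]
  have h2 := LinearMap.congr_fun this p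
  simp only [LinearMap.comp_apply, LinearMap.mulRight_apply] at h2
  rw [h2]
  split_ifs <;> rfl

theorem mul_letter_mem_degLT {d : ℕ} {p : NCPoly g} (a : Fin g ⊕ Fin g) (hp : p ∈ degLT g d) :
    p * letter a ∈ degLT g (d + 1) := by
  rw [degLT_eq_span] at hp
  induction hp using Submodule.span_induction with
  | mem x hx =>
    obtain ⟨w, hw, rfl⟩ := hx
    have : word w * letter a = word (w ++ [a]) := by simp [word_append]
    rw [this]
    exact word_mem_degLT (by simpa using hw)
  | zero => simp
  | add x y _ _ hx hy => rw [add_mul]; exact Submodule.add_mem _ hx hy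
  | smul c x _ hx => rw [smul_mul_assoc]; exact Submodule.smul_mem _ _ hx

/-- Right division by a letter: `p = p(0) + ∑ (rightDiv a p) * a`. -/
noncomputable def rightDiv (a : Fin g ⊕ Fin g) : NCPoly g →ₗ[ℝ] NCPoly g :=
  (wordBasis g).constr ℝ fun w => if w.getLast? = some a then word w.dropLast else 0

theorem coeff_rightDiv (a : Fin g ⊕ Fin g) (w : List (Fin g ⊕ Fin g)) (p : NCPoly g) :
    coeff w (rightDiv a p) = coeff (w ++ [a]) p := by
  classical
  have : (coeff w).comp (rightDiv a) = coeff (w ++ [a]) := by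
    apply linearMap_ext
    intro u
    have h1 : rightDiv a (word u) = if u.getLast? = some a then word u.dropLast else 0 := by
      rw [rightDiv, ← wordBasis_apply u, Module.Basis.constr_basis]
    rw [LinearMap.comp_apply, h1, coeff_word]
    rcases List.eq_nil_or_concat' u with rfl | ⟨v, b, rfl⟩
    · simp
    · by_cases hb : b = a
      · subst hb
        simp [coeff_word]
      · simp [hb]
  exact LinearMap.congr_fun this p

theorem rightDiv_mem_degLT {d : ℕ} {p : NCPoly g} (a : Fin g ⊕ Fin g)
    (hp : p ∈ degLT g (d + 1)) : rightDiv a p ∈ degLT g d := by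
  intro w hw
  rw [coeff_rightDiv]
  exact hp _ (by simpa using hw)

instance : StarModule ℝ (NCPoly g) where
  star_smul c p := by
    rw [Algebra.smul_def, star_mul, star_algebraMap, ← Algebra.commutes, Algebra.smul_def]
    rfl

@[simp] theorem star_letter (a : Fin g ⊕ Fin g) : star (letter a) = letter a.swap := by
  simp [star_def, starHom]

end NCPoly

/-! ### Evaluation, actions of letters on finite index sets, monic pencils -/

section Evaluation

variable {g : ℕ}

theorem evalPoly_letter {n : ℕ} (X : MatTuple g n) (a : Fin g ⊕ Fin g) :
    evalPoly X (NCPoly.letter a) = Sum.elim X (fun i => (X i)ᵀ) a := by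
  simp [evalPoly]

theorem evalPoly_star {n : ℕ} (X : MatTuple g n) (p : NCPoly g) :
    evalPoly X (star p) = (evalPoly X p)ᵀ := by
  have h : (AlgHom.opComm ((Matrix.transposeAlgEquiv (Fin n) ℝ ℝ).toAlgHom.comp (evalPoly X))).comp
      NCPoly.starHom = evalPoly X := by
    apply NCPoly.hom_ext
    rintro (i | i) <;> simp [NCPoly.starHom, AlgHom.opComm, evalPoly_letter]
  have h2 := DFunLike.congr_fun h (star p)
  rw [← h2, NCPoly.star_def]
  simp [AlgHom.opComm, NCPoly.starHom_starHom]

variable {κ ν ℓ n : ℕ}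

theorem evalMat_apply (p : NCMat g ν ℓ) (X : MatTuple g n) (i : Fin ν) (j : Fin ℓ) (k m : Fin n) :
    evalMat p X (i, k) (j, m) = evalPoly X (p i j) k m := rfl

theorem evalMat_add (p q : NCMat g ν ℓ) (X : MatTuple g n) :
    evalMat (p + q) X = evalMat p X + evalMat q X := by
  ext ⟨i, k⟩ ⟨j, m⟩
  simp [evalMat_apply]

theorem evalMat_zero (X : MatTuple g n) : evalMat (0 : NCMat g ν ℓ) X = 0 := by
  ext ⟨i, k⟩ ⟨j, m⟩
  simp [evalMat_apply]

theorem evalMat_smul (c : ℝ) (p : NCMat g ν ℓ) (X : MatTuple g n) :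
    evalMat (c • p) X = c • evalMat p X := by
  ext ⟨i, k⟩ ⟨j, m⟩
  simp [evalMat_apply]

theorem evalMat_sum {ι : Type*} (s : Finset ι) (p : ι → NCMat g ν ℓ) (X : MatTuple g n) :
    evalMat (∑ i ∈ s, p i) X = ∑ i ∈ s, evalMat (p i) X := by
  classical
  induction s using Finset.induction_on with
  | empty => simp [evalMat_zero]
  | insert a s ha ih => rw [Finset.sum_insert ha, Finset.sum_insert ha, evalMat_add, ih]

theorem evalMat_mul (p : NCMat g κ ν) (q : NCMat g ν ℓ) (X : MatTuple g n) :
    evalMat (p * q) X = evalMat p X * evalMat q X := by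
  ext ⟨i, k⟩ ⟨j, m⟩
  simp [evalMat_apply, Matrix.mul_apply, Fintype.sum_prod_type, Matrix.sum_apply]

theorem evalMat_conjTranspose (p : NCMat g ν ℓ) (X : MatTuple g n) :
    evalMat pᴴ X = (evalMat p X)ᵀ := by
  ext ⟨i, k⟩ ⟨j, m⟩
  simp [evalMat_apply, evalPoly_star]

/-- The action of a matrix of polynomials on tuples of vectors, for letters acting by `Y`. -/
noncomputable def act {I : Type*} [Fintype I] [DecidableEq I]
    (Y : Fin g ⊕ Fin g → Matrix I I ℝ) (f : NCMat g ν ℓ) (v : Fin ℓ → I → ℝ) : Fin ν → I → ℝ :=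
  fun k => ∑ j, NCPoly.lift Y (f k j) *ᵥ v j

section Act

variable {I : Type*} [Fintype I] [DecidableEq I] (Y : Fin g ⊕ Fin g → Matrix I I ℝ)

theorem act_mul (f : NCMat g κ ν) (h : NCMat g ν ℓ) (v : Fin ℓ → I → ℝ) :
    act Y (f * h) v = act Y f (act Y h v) := by
  funext k
  simp only [act, Matrix.mul_apply, map_sum, map_mul, Matrix.sum_mulVec, Matrix.mulVec_sum,
    Matrix.mulVec_mulVec]
  exact Finset.sum_comm

theorem act_add (f h : NCMat g ν ℓ) (v : Fin ℓ → I → ℝ) :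
    act Y (f + h) v = act Y f v + act Y h v := by
  funext k
  simp [act, Matrix.add_mulVec, Finset.sum_add_distrib]

theorem act_sub (f h : NCMat g ν ℓ) (v : Fin ℓ → I → ℝ) :
    act Y (f - h) v = act Y f v - act Y h v := by
  funext k
  simp [act, Matrix.sub_mulVec, Finset.sum_sub_distrib]

theorem act_zero (f : NCMat g ν ℓ) : act Y f 0 = 0 := by
  funext k
  simp [act]

theorem act_constMat (C : Matrix (Fin ν) (Fin ℓ) ℝ) (v : Fin ℓ → I → ℝ) (k : Fin ν) :
    act Y (constMat C) v k = ∑ j, C k j • v j := by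
  simp [act, constMat, Algebra.algebraMap_eq_smul_one, Matrix.smul_mulVec]

end Act

/-- Symmetric actions on a finite index set are evaluations at matrix tuples. -/
theorem exists_matTuple {I : Type*} [Fintype I] [DecidableEq I]
    {Y : Fin g ⊕ Fin g → Matrix I I ℝ} (hY : ∀ a, Y a.swap = (Y a)ᵀ) :
    ∃ (n : ℕ) (X : MatTuple g n) (e : I ≃ Fin n),
      ∀ p, evalPoly X p = (NCPoly.lift Y p).reindex e e := by
  refine ⟨Fintype.card I, fun i => (Y (Sum.inl i)).reindex (Fintype.equivFin I) (Fintype.equivFin I),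
    Fintype.equivFin I, fun p => ?_⟩
  have h : evalPoly (fun i => (Y (Sum.inl i)).reindex (Fintype.equivFin I) (Fintype.equivFin I)) =
      (Matrix.reindexAlgEquiv ℝ ℝ (Fintype.equivFin I)).toAlgHom.comp (NCPoly.lift Y) := by
    apply NCPoly.hom_ext
    rintro (i | i)
    · simp [evalPoly_letter]
    · have := hY (Sum.inl i)
      rw [Sum.swap_inl] at this
      simp [evalPoly_letter, this]
  rw [h]
  rfl

theorem evalMat_mulVec_of_reindex {I : Type*} [Fintype I] [DecidableEq I]
    {Y : Fin g ⊕ Fin g → Matrix I I ℝ} {X : MatTuple g n} {e : I ≃ Fin n}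
    (h : ∀ p, evalPoly X p = (NCPoly.lift Y p).reindex e e) (f : NCMat g ν ℓ)
    (v : Fin ℓ → I → ℝ) :
    evalMat f X *ᵥ (fun jk => v jk.1 (e.symm jk.2)) =
      fun ik => act Y f v ik.1 (e.symm ik.2) := by
  funext ⟨i, k⟩
  simp only [Matrix.mulVec, dotProduct, Fintype.sum_prod_type, evalMat_apply, h, act,
    Finset.sum_apply, Matrix.reindex_apply, Matrix.submatrix_apply]
  refine Finset.sum_congr rfl fun j _ => ?_
  exact Equiv.sum_comp e.symm (fun m => NCPoly.lift Y (f i j) (e.symm k) m * v j m)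

/-- Inclusions of zero sets transfer to symmetric actions. -/
theorem act_eq_zero_of_matZeroSet_subset {L : NCMat g κ ℓ} {f : NCMat g ν ℓ}
    (h : ∀ n, matZeroSet L n ⊆ matZeroSet f n) {I : Type*} [Fintype I] [DecidableEq I]
    {Y : Fin g ⊕ Fin g → Matrix I I ℝ} (hY : ∀ a, Y a.swap = (Y a)ᵀ) {v : Fin ℓ → I → ℝ}
    (hv : act Y L v = 0) : act Y f v = 0 := by
  obtain ⟨n, X, e, hX⟩ := exists_matTuple hY
  have h1 : (X, fun jk : Fin ℓ × Fin n => v jk.1 (e.symm jk.2)) ∈ matZeroSet L n := by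
    simp only [matZeroSet, Set.mem_ofPred_eq, evalMat_mulVec_of_reindex hX, hv]
    rfl
  have h2 := h n h1
  simp only [matZeroSet, Set.mem_ofPred_eq, evalMat_mulVec_of_reindex hX] at h2
  funext i k
  simpa using congrFun h2 (i, e k)

theorem constMat_mul (A : Matrix (Fin κ) (Fin ν) ℝ) (B : Matrix (Fin ν) (Fin ℓ) ℝ) :
    (constMat (A * B) : NCMat g κ ℓ) = (constMat A : NCMat g κ ν) * (constMat B : NCMat g ν ℓ) := by
  simp [constMat, Matrix.map_mul]

theorem constMat_one : (constMat (1 : Matrix (Fin ℓ) (Fin ℓ) ℝ) : NCMat g ℓ ℓ) = 1 := by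
  simp [constMat, Matrix.map_one]

theorem constMat_sub (A B : Matrix (Fin κ) (Fin ν) ℝ) :
    (constMat (A - B) : NCMat g κ ν) = constMat A - constMat B := by
  simp [constMat, Matrix.map_sub]

theorem constMat_mul_tens (C : Matrix (Fin κ) (Fin ν) ℝ) (A : Matrix (Fin ν) (Fin ℓ) ℝ)
    (a : NCPoly g) : (constMat C : NCMat g κ ν) * tens A a = tens (C * A) a := by
  ext i j
  simp [constMat, tens, Matrix.mul_apply, Finset.sum_smul, Algebra.algebraMap_eq_smul_one, smul_smul,
    mul_comm]

theorem tens_mul_constMat (A : Matrix (Fin κ) (Fin ν) ℝ) (C : Matrix (Fin ν) (Fin ℓ) ℝ)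
    (a : NCPoly g) : tens A a * (constMat C : NCMat g ν ℓ) = tens (A * C) a := by
  ext i j
  simp [constMat, tens, Matrix.mul_apply, Finset.sum_smul, Algebra.algebraMap_eq_smul_one, smul_smul,
    mul_comm]

/-- The monic pencil with coefficients `A a` at the letters `a`. -/
noncomputable def pencil (A : Fin g ⊕ Fin g → Matrix (Fin ℓ) (Fin ℓ) ℝ) : NCMat g ℓ ℓ :=
  1 + ∑ a, tens (A a) (NCPoly.letter a)

theorem IsMonicLinearPencil.exists_eq_pencil {L : NCMat g ℓ ℓ} (hL : IsMonicLinearPencil L) :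
    ∃ A : Fin g ⊕ Fin g → Matrix (Fin ℓ) (Fin ℓ) ℝ, (∀ a, A a.swap = (A a)ᵀ) ∧ L = pencil A := by
  obtain ⟨A, rfl⟩ := hL
  refine ⟨Sum.elim A fun i => (A i)ᵀ, ?_, ?_⟩
  · rintro (i | i) <;> simp
  · simp [pencil, NCPoly.x, NCPoly.xs, add_assoc]

section Pencil

variable (A : Fin g ⊕ Fin g → Matrix (Fin ℓ) (Fin ℓ) ℝ)

theorem pencil_apply (i j : Fin ℓ) :
    pencil A i j = (1 : Matrix (Fin ℓ) (Fin ℓ) ℝ) i j • 1 + ∑ a, A a i j • NCPoly.letter a := by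
  simp only [pencil, Matrix.add_apply, Matrix.sum_apply, tens, Matrix.map_apply, Matrix.one_apply]
  split_ifs <;> simp

theorem mul_pencil_apply (f : NCMat g ν ℓ) (i : Fin ν) (j : Fin ℓ) :
    (f * pencil A) i j = f i j + ∑ a, ∑ k, A a k j • (f i k * NCPoly.letter a) := by
  simp only [pencil, Matrix.mul_add, Matrix.mul_one, Matrix.add_apply, Matrix.mul_sum,
    Matrix.sum_apply]
  simp only [Matrix.mul_apply, tens, Matrix.map_apply, mul_smul_comm]

theorem pencil_conjTranspose (hA : ∀ a, A a.swap = (A a)ᵀ) : (pencil A)ᴴ = pencil A := by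
  ext i j
  rw [Matrix.conjTranspose_apply, pencil_apply, pencil_apply, star_add, star_sum]
  congr 1
  · by_cases h : i = j
    · subst h
      simp
    · simp [h, Ne.symm h]
  · rw [← (Equiv.sumComm (Fin g) (Fin g)).sum_comp]
    refine Finset.sum_congr rfl fun a _ => ?_
    simp [hA]

theorem evalMat_pencil_transpose (hA : ∀ a, A a.swap = (A a)ᵀ) (X : MatTuple g n) :
    (evalMat (pencil A) X)ᵀ = evalMat (pencil A) X := by
  rw [← evalMat_conjTranspose, pencil_conjTranspose A hA]

theorem act_pencil {I : Type*} [Fintype I] [DecidableEq I] (Y : Fin g ⊕ Fin g → Matrix I I ℝ)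
    (v : Fin ℓ → I → ℝ) (i : Fin ℓ) :
    act Y (pencil A) v i = v i + ∑ a, ∑ j, A a i j • (Y a *ᵥ v j) := by
  simp only [act, pencil_apply, map_add, map_sum, map_smul, NCPoly.lift_letter, map_one,
    Matrix.add_mulVec, Matrix.sum_mulVec, Finset.sum_add_distrib, Matrix.smul_mulVec,
    Matrix.one_mulVec]
  rw [Finset.sum_comm]
  congr 1
  simp [Matrix.one_apply]

theorem constMat_comm_pencil {C : Matrix (Fin ℓ) (Fin ℓ) ℝ} (h : ∀ a, A a * C = C * A a) :
    (constMat C : NCMat g ℓ ℓ) * pencil A = pencil A * (constMat C : NCMat g ℓ ℓ) := by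
  simp only [pencil, Matrix.mul_add, Matrix.add_mul, Matrix.mul_one, Matrix.one_mul,
    Matrix.mul_sum, Matrix.sum_mul, constMat_mul_tens, tens_mul_constMat, h]

end Pencil

end Evaluation

/-! ### Truncated Fock space with a finite-dimensional part attached -/

section FockModel

variable {g : ℕ}

/-- Words of length at most `N`. -/
abbrev BoundedWord (g N : ℕ) : Type := {w : List (Fin g ⊕ Fin g) // w.length ≤ N}

noncomputable instance (N : ℕ) : Fintype (BoundedWord g N) :=
  (List.finite_length_le (Fin g ⊕ Fin g) N).fintype

/-- The creation operator of a letter on the truncated Fock space. -/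
def creation (N : ℕ) (a : Fin g ⊕ Fin g) : Matrix (BoundedWord g N) (BoundedWord g N) ℝ :=
  Matrix.of fun u w => if u.1 = a :: w.1 then 1 else 0

/-- The vacuum vector of the truncated Fock space. -/
def vacuum (g N : ℕ) : BoundedWord g N → ℝ := fun w => if w.1 = [] then 1 else 0

variable {H : Type*}

/-- Letters acting on `ℝ^H` by `D`, on the truncated Fock space as creation plus annihilation
operators, and coupled by the functionals `b` and the vacuum vector. -/
noncomputable def fockModel (N : ℕ) (D : Fin g ⊕ Fin g → Matrix H H ℝ) (b : Fin g ⊕ Fin g → H → ℝ)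
    (a : Fin g ⊕ Fin g) : Matrix (H ⊕ BoundedWord g N) (H ⊕ BoundedWord g N) ℝ :=
  Matrix.fromBlocks (D a) (Matrix.vecMulVec (b a.swap) (vacuum g N))
    (Matrix.vecMulVec (vacuum g N) (b a)) (creation N a + (creation N a.swap)ᵀ)

variable {N : ℕ} {D : Fin g ⊕ Fin g → Matrix H H ℝ} {b : Fin g ⊕ Fin g → H → ℝ}

/-- The upper coupling block carries `b a.swap` and the lower one `b a`, so transposition exchanges
them. This symmetry is what makes the model an evaluation point for polynomials in `x` and `x*`. -/
theorem fockModel_swap (hD : ∀ a, D a.swap = (D a)ᵀ) (a : Fin g ⊕ Fin g) :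
    fockModel N D b a.swap = (fockModel N D b a)ᵀ := by
  simp [fockModel, Matrix.fromBlocks_transpose, hD, Matrix.transpose_vecMulVec, add_comm]

variable [Fintype H]

theorem fockModel_mulVec_inr (a : Fin g ⊕ Fin g) (ζ : H ⊕ BoundedWord g N → ℝ)
    (u : BoundedWord g N) :
    (fockModel N D b a *ᵥ ζ) (Sum.inr u) =
      vacuum g N u * (b a ⬝ᵥ (ζ ∘ Sum.inl)) +
        ((∑ w, if u.1 = a :: w.1 then ζ (Sum.inr w) else 0) +
          ∑ w, if w.1 = a.swap :: u.1 then ζ (Sum.inr w) else 0) := by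
  simp [fockModel, Matrix.mulVec, dotProduct, creation, Matrix.vecMulVec_apply, Finset.mul_sum,
    mul_assoc, add_mul, Finset.sum_add_distrib]

theorem fockModel_mulVec_inl (a : Fin g ⊕ Fin g) (ζ : H ⊕ BoundedWord g N → ℝ) (h : H)
    (hζ : ∀ w, ζ (Sum.inr w) = 0) :
    (fockModel N D b a *ᵥ ζ) (Sum.inl h) = (D a *ᵥ (ζ ∘ Sum.inl)) h := by
  have : ζ ∘ Sum.inr = (0 : BoundedWord g N → ℝ) := funext hζ
  simp [fockModel, Matrix.fromBlocks_mulVec, this]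

/-- Above the degree of the argument, a letter acts as its creation operator. -/
theorem fockModel_mulVec_cons (a c : Fin g ⊕ Fin g) (ζ : H ⊕ BoundedWord g N → ℝ)
    (u : List (Fin g ⊕ Fin g)) (hu : (c :: u).length ≤ N)
    (hζ : ∀ w : BoundedWord g N, u.length < w.1.length → ζ (Sum.inr w) = 0) :
    (fockModel N D b a *ᵥ ζ) (Sum.inr ⟨c :: u, hu⟩) =
      if c = a then ζ (Sum.inr ⟨u, (Nat.le_succ _).trans hu⟩) else 0 := by
  rw [fockModel_mulVec_inr]
  have h1 : ∑ w : BoundedWord g N, (if w.1 = a.swap :: c :: u then ζ (Sum.inr w) else 0) = 0 := by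
    refine Finset.sum_eq_zero fun w _ => ?_
    split_ifs with h
    · apply hζ
      rw [h]
      simp only [List.length_cons]
      omega
    · rfl
  have h2 : ∑ w : BoundedWord g N, (if c :: u = a :: w.1 then ζ (Sum.inr w) else 0) =
      if c = a then ζ (Sum.inr ⟨u, (Nat.le_succ _).trans hu⟩) else 0 := by
    rw [Finset.sum_eq_single ⟨u, (Nat.le_succ _).trans hu⟩]
    · simp
    · intro w _ hw
      rw [if_neg]
      intro h
      exact hw (Subtype.ext (List.cons.inj h).2.symm)
    · simp
  simp only [h1, h2]
  simp [vacuum]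

variable [DecidableEq H]

/-- Each letter raises the Fock degree by at most one, and only its creation part does so. Hence a
word applied to the vacuum reaches its own length in exactly one component, the one indexed by the
word itself. -/
theorem fockModel_word_mulVec (v : List (Fin g ⊕ Fin g)) (ζ : H ⊕ BoundedWord g N → ℝ) (c : ℝ)
    (hζ : ∀ w, ζ (Sum.inr w) = vacuum g N w * c) (u : BoundedWord g N)
    (hu : v.length ≤ u.1.length) :
    (NCPoly.lift (fockModel N D b) (NCPoly.word v) *ᵥ ζ) (Sum.inr u) =
      if u.1 = v then c else 0 := by
  induction v generalizing u with
  | nil => simp [hζ, vacuum]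
  | cons a v ih =>
    obtain ⟨u, hN⟩ := u
    cases u with
    | nil => simp at hu
    | cons e u =>
      simp only [List.length_cons, Nat.add_le_add_iff_right] at hu
      rw [NCPoly.word_cons, map_mul, NCPoly.lift_letter, ← Matrix.mulVec_mulVec,
        fockModel_mulVec_cons]
      · rw [ih _ hu]
        by_cases h1 : e = a <;> by_cases h2 : u = v <;> simp [h1, h2]
      · intro w hw
        rw [ih _ (hu.trans hw.le), if_neg]
        rintro rfl
        omega

/-- The top Fock components of `f(X) ζ`, where the Fock part of `ζ` is a multiple of the vacuum. -/
theorem fockModel_poly_mulVec (ζ : H ⊕ BoundedWord g N → ℝ) (c : ℝ)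
    (hζ : ∀ w, ζ (Sum.inr w) = vacuum g N w * c) (u : BoundedWord g N) {f : NCPoly g}
    (hf : f ∈ NCPoly.degLT g (u.1.length + 1)) :
    (NCPoly.lift (fockModel N D b) f *ᵥ ζ) (Sum.inr u) = NCPoly.coeff u.1 f * c := by
  rw [NCPoly.degLT_eq_span] at hf
  induction hf using Submodule.span_induction with
  | mem x hx =>
    obtain ⟨v, hv, rfl⟩ := hx
    rw [fockModel_word_mulVec v ζ c hζ u (Nat.lt_succ_iff.1 hv), NCPoly.coeff_word]
    simp [eq_comm]
  | zero => simp
  | add x y _ _ hx hy => simp [Matrix.add_mulVec, hx, hy, add_mul]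
  | smul r x _ hx => simp [Matrix.smul_mulVec, hx, mul_assoc]

/-- The top Fock components of `f(X) ζ`, where `ζ` lies in `ℝ^H`. -/
theorem fockModel_poly_mulVec_inl (ζ : H ⊕ BoundedWord g N → ℝ)
    (hζ : ∀ w, ζ (Sum.inr w) = 0) (u : BoundedWord g N) {f : NCPoly g}
    (hf : f ∈ NCPoly.degLT g (u.1.length + 2)) :
    (NCPoly.lift (fockModel N D b) f *ᵥ ζ) (Sum.inr u) =
      ∑ a, NCPoly.coeff (u.1 ++ [a]) f * (b a ⬝ᵥ (ζ ∘ Sum.inl)) := by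
  rw [NCPoly.degLT_eq_span] at hf
  induction hf using Submodule.span_induction with
  | mem x hx =>
    obtain ⟨v, hv, rfl⟩ := hx
    rcases List.eq_nil_or_concat' v with rfl | ⟨v, a, rfl⟩
    · rw [Finset.sum_eq_zero]
      · simp [hζ]
      · intro a _
        rw [NCPoly.coeff_word, if_neg (by simp), zero_mul]
    · have h1 : ∀ w, (fockModel N D b a *ᵥ ζ) (Sum.inr w) =
          vacuum g N w * (b a ⬝ᵥ (ζ ∘ Sum.inl)) := by
        intro w
        simp [fockModel_mulVec_inr, hζ]
      rw [NCPoly.word_append, map_mul, ← Matrix.mulVec_mulVec]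
      simp only [NCPoly.word_cons, NCPoly.word_nil, mul_one, NCPoly.lift_letter]
      rw [fockModel_word_mulVec v _ _ h1 u (by simpa using hv), Finset.sum_eq_single a]
      · have : NCPoly.word v * NCPoly.letter a = NCPoly.word (v ++ [a]) := by
          simp [NCPoly.word_append]
        rw [this, NCPoly.coeff_word]
        simp [eq_comm]
      · intro e _ he
        have : NCPoly.word v * NCPoly.letter a = NCPoly.word (v ++ [a]) := by
          simp [NCPoly.word_append]
        rw [this, NCPoly.coeff_word, if_neg, zero_mul]
        intro h
        simp only [List.append_singleton_inj] at h
        exact he h.2.symm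
      · simp
  | zero => simp
  | add x y _ _ hx hy => simp [Matrix.add_mulVec, hx, hy, add_mul, Finset.sum_add_distrib]
  | smul r x _ hx => simp [Matrix.smul_mulVec, hx, mul_assoc, Finset.mul_sum, mul_add]

end FockModel

/-! ### Tuples at which no nonzero polynomial of bounded degree vanishes -/

section Faithful

variable {g ℓ n : ℕ}

/-- There is a matrix tuple at which no nonzero polynomial of degree less than `d` vanishes. -/
theorem exists_faithful (g d : ℕ) :
    ∃ (n : ℕ) (X : MatTuple g n), ∀ f ∈ NCPoly.degLT g d, evalPoly X f = 0 → f = 0 := by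
  -- With `H` empty only the Fock space remains. Applied to the vacuum, a polynomial shows its top
  -- coefficients, so vanishing strips off one degree at a time.
  obtain ⟨n, X, e, hX⟩ := exists_matTuple
    (fockModel_swap (g := g) (H := Empty) (N := d) (D := fun _ => 0) (b := fun _ => 0) (by simp))
  refine ⟨n, X, fun f hf hf0 => ?_⟩
  have h0 : NCPoly.lift (fockModel (H := Empty) d (fun _ => 0) fun _ => 0) f = 0 := by
    rw [hX] at hf0
    exact (Matrix.reindex e e).injective (by rw [hf0]; rfl)
  have key : ∀ k ≤ d, f ∈ NCPoly.degLT g k → f = 0 := by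
    intro k
    induction k with
    | zero => exact fun _ h => NCPoly.degLT_zero h
    | succ k ih =>
      intro hk h
      refine ih (by omega) (NCPoly.degLT_of_top h fun w hw => ?_)
      have := fockModel_poly_mulVec (N := d) (D := fun _ => (0 : Matrix Empty Empty ℝ))
        (b := fun _ => 0) (Sum.elim 0 (vacuum g d)) 1 (by simp) ⟨w, by omega⟩ (f := f)
        (by simpa [hw] using h)
      rw [h0] at this
      simpa using this.symm
  exact key d le_rfl hf

/-- The substitution scaling all letters by `t`. -/
noncomputable def NCPoly.scale (t : ℝ) : NCPoly g →ₐ[ℝ] NCPoly g :=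
  NCPoly.lift fun a => t • NCPoly.letter a

theorem NCPoly.scale_word (t : ℝ) (w : List (Fin g ⊕ Fin g)) :
    NCPoly.scale t (NCPoly.word w) = t ^ w.length • NCPoly.word w := by
  induction w with
  | nil => simp
  | cons a w ih =>
    rw [NCPoly.word_cons, map_mul, ih, NCPoly.scale, NCPoly.lift_letter, List.length_cons, pow_succ']
    simp [smul_smul, mul_comm]

theorem NCPoly.coeff_scale (t : ℝ) (w : List (Fin g ⊕ Fin g)) (f : NCPoly g) :
    NCPoly.coeff w (NCPoly.scale t f) = t ^ w.length * NCPoly.coeff w f := by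
  have : (NCPoly.coeff w).comp (NCPoly.scale t).toLinearMap = t ^ w.length • NCPoly.coeff w := by
    apply NCPoly.linearMap_ext
    intro u
    simp only [LinearMap.comp_apply, AlgHom.toLinearMap_apply, NCPoly.scale_word, map_smul,
      NCPoly.coeff_word, LinearMap.smul_apply]
    split_ifs with h
    · simp [h]
    · simp
  exact LinearMap.congr_fun this f

theorem evalPoly_smul (t : ℝ) (X : MatTuple g n) (f : NCPoly g) :
    evalPoly (t • X) f = evalPoly X (NCPoly.scale t f) := by
  have : evalPoly (t • X) = (evalPoly X).comp (NCPoly.scale t) := by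
    apply NCPoly.hom_ext
    rintro (i | i) <;> simp [NCPoly.scale, evalPoly_letter]
  exact DFunLike.congr_fun this f

/-- The quadratic form of `M` is at most `c * ‖x‖²` in absolute value, with `c` the sum of the
absolute values of the entries, so `t = 1/(c+1)` works. That `t` is nonzero keeps faithfulness
intact when a tuple is rescaled by it. -/
theorem exists_posDef_one_add_smul {ι : Type*} [Fintype ι] [DecidableEq ι] (M : Matrix ι ι ℝ)
    (hM : Mᵀ = M) : ∃ t : ℝ, t ≠ 0 ∧ (1 + t • M).PosDef := by
  set c := ∑ i, ∑ j, |M i j| with hc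
  have hc0 : 0 ≤ c := Finset.sum_nonneg fun i _ => Finset.sum_nonneg fun j _ => abs_nonneg _
  have bound : ∀ x : ι → ℝ, |x ⬝ᵥ (M *ᵥ x)| ≤ c * (x ⬝ᵥ x) := by
    intro x
    simp only [dotProduct, Matrix.mulVec, Finset.mul_sum]
    refine (Finset.abs_sum_le_sum_abs _ _).trans ?_
    rw [← Finset.mul_sum, hc, Finset.sum_mul]
    refine Finset.sum_le_sum fun i _ => (Finset.abs_sum_le_sum_abs _ _).trans ?_
    rw [Finset.sum_mul]
    refine Finset.sum_le_sum fun j _ => ?_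
    rw [abs_mul, abs_mul, mul_left_comm]
    refine mul_le_mul_of_nonneg_left ?_ (abs_nonneg _)
    have h1 : ∀ k, x k * x k ≤ ∑ m, x m * x m := fun k =>
      Finset.single_le_sum (f := fun m => x m * x m) (fun m _ => mul_self_nonneg _)
        (Finset.mem_univ k)
    nlinarith [h1 i, h1 j, sq_nonneg (|x i| - |x j|), abs_mul_abs_self (x i),
      abs_mul_abs_self (x j)]
  have hpos : 0 < c + 1 := by linarith
  refine ⟨(c + 1)⁻¹, inv_ne_zero hpos.ne', ?_⟩
  refine Matrix.PosDef.of_dotProduct_mulVec_pos ?_ fun x hx => ?_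
  · rw [Matrix.IsHermitian, Matrix.conjTranspose_eq_transpose_of_trivial]
    simp [hM]
  · have hxx : 0 < x ⬝ᵥ x := by simpa using Matrix.dotProduct_star_self_pos_iff.2 hx
    rw [star_trivial, Matrix.add_mulVec, Matrix.one_mulVec, Matrix.smul_mulVec, dotProduct_add,
      dotProduct_smul, smul_eq_mul]
    have h1 := (abs_le.1 (bound x)).1
    have h2 : (c + 1)⁻¹ * (-(c * (x ⬝ᵥ x))) ≤ (c + 1)⁻¹ * (x ⬝ᵥ (M *ᵥ x)) :=
      mul_le_mul_of_nonneg_left h1 (inv_pos.2 hpos).le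
    have h3 : x ⬝ᵥ x + (c + 1)⁻¹ * (-(c * (x ⬝ᵥ x))) = (c + 1)⁻¹ * (x ⬝ᵥ x) := by
      field_simp
      ring
    have := mul_pos (inv_pos.2 hpos) hxx
    linarith

/-- A monic pencil is positive definite at some tuple at which no nonzero polynomial of degree
less than `d` vanishes. -/
theorem exists_faithful_posDef (A : Fin g ⊕ Fin g → Matrix (Fin ℓ) (Fin ℓ) ℝ)
    (hA : ∀ a, A a.swap = (A a)ᵀ) (d : ℕ) :
    ∃ (n : ℕ) (X : MatTuple g n), (∀ f ∈ NCPoly.degLT g d, evalPoly X f = 0 → f = 0) ∧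
      (evalMat (pencil A) X).PosDef := by
  obtain ⟨n, X, hX⟩ := exists_faithful g d
  -- A monic pencil satisfies `L(tX) = 1 + t(L(X) - 1)`, while the rescaling multiplies the
  -- coefficient of `w` by `t ^ w.length`.
  obtain ⟨t, ht0, ht⟩ := exists_posDef_one_add_smul (evalMat (pencil A) X - 1) (by
    rw [Matrix.transpose_sub, evalMat_pencil_transpose A hA, Matrix.transpose_one])
  refine ⟨n, t • X, fun f hf h => ?_, ?_⟩
  · rw [evalPoly_smul] at h
    have h2 := hX _ (fun w hw => by rw [NCPoly.coeff_scale, hf w hw, mul_zero]) h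
    refine NCPoly.eq_of_coeff fun w => ?_
    have h3 := NCPoly.coeff_scale t w f
    rw [h2, map_zero] at h3
    rw [map_zero]
    exact (mul_eq_zero.1 h3.symm).resolve_left (pow_ne_zero _ ht0)
  · convert ht using 1
    ext ⟨i, k⟩ ⟨j, m⟩
    have h1 : (1 : Matrix (Fin ℓ × Fin n) (Fin ℓ × Fin n) ℝ) (i, k) (j, m) =
        (1 : Matrix (Fin ℓ) (Fin ℓ) ℝ) i j * (1 : Matrix (Fin n) (Fin n) ℝ) k m := by
      simp only [Matrix.one_apply, Prod.mk.injEq]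
      split_ifs <;> simp_all
    simp only [Matrix.add_apply, Matrix.smul_apply, Matrix.sub_apply, evalMat_apply, pencil_apply,
      h1, evalPoly_smul, NCPoly.scale, map_add, map_smul, map_sum, NCPoly.lift_letter, map_one,
      smul_eq_mul, Matrix.sum_apply]
    rw [add_sub_cancel_left, Finset.mul_sum]
    congr 1
    refine Finset.sum_congr rfl fun a _ => ?_
    ring

end Faithful

/-! ### Closedness of cones of sums of quadratic values, and separation -/

section Separation

open Pointwise

/-- The finite sums of values of a quadratic map. -/
def quadCone {W V : Type*} [AddCommGroup W] [Module ℝ W] [AddCommGroup V] [Module ℝ V]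
    (b : W →ₗ[ℝ] W →ₗ[ℝ] V) : Set V :=
  {c | ∃ (N : ℕ) (x : Fin N → W), c = ∑ i, b (x i) (x i)}

section Algebraic

variable {W V : Type*} [AddCommGroup W] [Module ℝ W] [AddCommGroup V] [Module ℝ V]
  (b : W →ₗ[ℝ] W →ₗ[ℝ] V)

theorem mem_quadCone_self (x : W) : b x x ∈ quadCone b := ⟨1, fun _ => x, by simp⟩

theorem zero_mem_quadCone : (0 : V) ∈ quadCone b := ⟨0, Fin.elim0, by simp⟩

theorem add_mem_quadCone {c d : V} (hc : c ∈ quadCone b) (hd : d ∈ quadCone b) :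
    c + d ∈ quadCone b := by
  obtain ⟨N, x, rfl⟩ := hc
  obtain ⟨M, y, rfl⟩ := hd
  exact ⟨N + M, Fin.append x y, by simp [Fin.sum_univ_add]⟩

theorem smul_mem_quadCone {c : V} (hc : c ∈ quadCone b) {t : ℝ} (ht : 0 ≤ t) :
    t • c ∈ quadCone b := by
  obtain ⟨N, x, rfl⟩ := hc
  refine ⟨N, fun i => Real.sqrt t • x i, ?_⟩
  simp [Finset.smul_sum, smul_smul, Real.mul_self_sqrt ht]

theorem convex_quadCone : Convex ℝ (quadCone b) := fun _ hc _ hd _ _ hs ht _ =>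
  add_mem_quadCone b (smul_mem_quadCone b hc hs) (smul_mem_quadCone b hd ht)

end Algebraic

/-- In finite dimensions the convex hull of a compact set is compact. -/
theorem IsCompact.convexHull_of_finiteDimensional {E : Type*} [NormedAddCommGroup E]
    [NormedSpace ℝ E] [FiniteDimensional ℝ E] {s : Set E} (hs : IsCompact s) :
    IsCompact (convexHull ℝ s) := by
  -- Carathéodory: this many points suffice, so the hull is a continuous image of a simplex times a
  -- power of `s`. Shorter combinations are padded with weight zero at an arbitrary point `s₀`.
  let m := Module.finrank ℝ E + 1
  let F : (Fin m → ℝ) × (Fin m → E) → E := fun y => ∑ i, y.1 i • y.2 i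
  have hF : Continuous F := by fun_prop
  have hcomp : IsCompact (stdSimplex ℝ (Fin m) ×ˢ Set.pi Set.univ fun _ : Fin m => s) :=
    (isCompact_stdSimplex ℝ (Fin m)).prod (isCompact_univ_pi fun _ => hs)
  convert hcomp.image hF
  ext x
  constructor
  · intro hx
    obtain ⟨ι, _, z, w, hz, hind, hw, hw1, rfl⟩ := eq_pos_convex_span_of_mem_convexHull hx
    have hcard : Fintype.card ι ≤ m :=
      hind.card_le_finrank_succ.trans (Nat.succ_le_succ (Submodule.finrank_le _))
    let e : ι → Fin m := fun i => Fin.castLE hcard (Fintype.equivFin ι i)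
    have he : Function.Injective e :=
      (Fin.castLE_injective hcard).comp (Fintype.equivFin ι).injective
    obtain ⟨s₀, hs₀⟩ : s.Nonempty := convexHull_nonempty_iff.1 ⟨_, hx⟩
    have hext : ∀ j, j ∉ Set.range e → Function.extend e w 0 j = 0 := fun j hj =>
      Function.extend_apply' _ _ _ (by simpa using hj)
    refine ⟨(Function.extend e w 0, Function.extend e z fun _ => s₀), ⟨⟨fun j => ?_, ?_⟩, ?_⟩, ?_⟩
    · by_cases hj : j ∈ Set.range e
      · obtain ⟨i, rfl⟩ := hj
        simpa only [he.extend_apply] using (hw i).le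
      · exact (hext j hj).ge
    · rw [← hw1]
      exact (Fintype.sum_of_injective e he w _ hext fun i => (he.extend_apply _ _ i).symm).symm
    · intro j _
      by_cases hj : j ∈ Set.range e
      · obtain ⟨i, rfl⟩ := hj
        simp only [he.extend_apply]
        exact hz ⟨i, rfl⟩
      · simp only [Function.extend_apply' (f := e) z _ j (by simpa using hj)]
        exact hs₀
    · refine (Fintype.sum_of_injective e he (fun i => w i • z i) _ (fun j hj => ?_)
        fun i => ?_).symm
      · simp [hext j hj]
      · simp [he.extend_apply]
  · rintro ⟨⟨w, z⟩, ⟨⟨hw0, hw1⟩, hz⟩, rfl⟩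
    exact (convex_convexHull ℝ s).sum_mem (fun i _ => hw0 i) hw1
      fun i _ => subset_convexHull ℝ s (hz i trivial)

section Topological

variable {W V : Type*} [NormedAddCommGroup W] [NormedSpace ℝ W]
  [NormedAddCommGroup V] [NormedSpace ℝ V]
  (b : W →ₗ[ℝ] W →ₗ[ℝ] V)

theorem quad_mem_smul (x : W) :
    b x x ∈ (‖x‖ ^ 2) • convexHull ℝ ((fun x => b x x) '' Metric.closedBall 0 1) := by
  rcases eq_or_ne x 0 with rfl | hx
  · refine ⟨0, subset_convexHull ℝ _ ⟨0, by simp, by simp⟩, by simp⟩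
  · refine ⟨b (‖x‖⁻¹ • x) (‖x‖⁻¹ • x), subset_convexHull ℝ _ ⟨‖x‖⁻¹ • x, ?_, rfl⟩, ?_⟩
    · simp [norm_smul, hx]
    · have : ‖x‖ ≠ 0 := norm_ne_zero_iff.2 hx
      simp only [map_smul, LinearMap.smul_apply, smul_smul]
      field_simp
      simp

/-- Dilates of a convex set add by adding their factors, so a sum lies in a dilate controlled by `∑
‖x i‖²` alone, however many summands it has. -/
theorem sum_quad_mem_smul {N : ℕ} (x : Fin N → W) :
    ∑ i, b (x i) (x i) ∈
      (∑ i, ‖x i‖ ^ 2) • convexHull ℝ ((fun x => b x x) '' Metric.closedBall 0 1) := by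
  induction N with
  | zero => exact ⟨0, subset_convexHull ℝ _ ⟨0, by simp, by simp⟩, by simp⟩
  | succ N ih =>
    rw [Fin.sum_univ_succ, Fin.sum_univ_succ, (convex_convexHull ℝ _).add_smul (sq_nonneg _)
      (Finset.sum_nonneg fun i _ => sq_nonneg _)]
    exact Set.add_mem_add (quad_mem_smul b _) (ih _)

variable [FiniteDimensional ℝ W]

theorem continuous_quad : Continuous fun x => b x x := by
  let b' : W →L[ℝ] W →L[ℝ] V :=
    LinearMap.toContinuousLinearMap (LinearMap.toContinuousLinearMap.toLinearMap ∘ₗ b)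
  exact (b'.continuous.clm_apply continuous_id : Continuous fun x => b' x x)

variable [FiniteDimensional ℝ V]

/-- By homogeneity, `ε` is the minimum over the compact unit sphere, which is empty only for the
zero space. -/
theorem exists_quad_lower_bound (φ : V →ₗ[ℝ] ℝ) (hφ : ∀ x, x ≠ 0 → 0 < φ (b x x)) :
    ∃ ε > 0, ∀ x, ε * ‖x‖ ^ 2 ≤ φ (b x x) := by
  have hc : Continuous fun x => φ (b x x) :=
    LinearMap.continuous_of_finiteDimensional φ |>.comp (continuous_quad b)
  rcases (Metric.sphere (0 : W) 1).eq_empty_or_nonempty with he | hne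
  · refine ⟨1, one_pos, fun x => ?_⟩
    have : x = 0 := by
      by_contra hx
      have : ‖x‖⁻¹ • x ∈ Metric.sphere (0 : W) 1 := by simp [norm_smul, hx]
      rw [he] at this
      exact this
    simp [this]
  · obtain ⟨z, hz, hmin⟩ := (isCompact_sphere (0 : W) 1).exists_isMinOn hne hc.continuousOn
    have hz0 : z ≠ 0 := by
      rintro rfl
      simp at hz
    refine ⟨φ (b z z), hφ z hz0, fun x => ?_⟩
    rcases eq_or_ne x 0 with rfl | hx
    · simp
    · have h1 : φ (b z z) ≤ φ (b (‖x‖⁻¹ • x) (‖x‖⁻¹ • x)) :=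
        hmin (show ‖x‖⁻¹ • x ∈ Metric.sphere (0 : W) 1 by simp [norm_smul, hx])
      have h2 : 0 < ‖x‖ := norm_pos_iff.2 hx
      simp only [map_smul, LinearMap.smul_apply, smul_eq_mul] at h1
      calc φ (b z z) * ‖x‖ ^ 2 ≤ (‖x‖⁻¹ * (‖x‖⁻¹ * φ (b x x))) * ‖x‖ ^ 2 := by gcongr
        _ = φ (b x x) := by field_simp

theorem isCompact_convexHull_quad_ball :
    IsCompact (convexHull ℝ ((fun x => b x x) '' Metric.closedBall 0 1)) :=
  ((isCompact_closedBall 0 1).image (continuous_quad b)).convexHull_of_finiteDimensional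

/-- Strict positivity of `φ` bounds `∑ ‖x i‖²` by `φ` of the sum. Near a limit point `c` the cone
therefore lies in a fixed dilate of the compact set `K`, and that dilate is itself contained in the
cone. -/
theorem isClosed_quadCone (φ : V →ₗ[ℝ] ℝ) (hφ : ∀ x, x ≠ 0 → 0 < φ (b x x)) :
    IsClosed (quadCone b) := by
  set K := convexHull ℝ ((fun x => b x x) '' Metric.closedBall 0 1) with hK
  have hKC : K ⊆ quadCone b := by
    refine convexHull_min ?_ (convex_quadCone b)
    rintro _ ⟨x, _, rfl⟩
    exact mem_quadCone_self b x
  have h0K : (0 : V) ∈ K := subset_convexHull ℝ _ ⟨0, by simp, by simp⟩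
  have hφc : Continuous φ := LinearMap.continuous_of_finiteDimensional φ
  obtain ⟨ε, hε, hbound⟩ := exists_quad_lower_bound b φ hφ
  refine isClosed_of_closure_subset fun c hc => ?_
  have hbd : ∀ d ∈ quadCone b, φ d ≤ φ c + 1 → d ∈ ((|φ c| + 1) / ε) • K := by
    rintro d ⟨N, x, rfl⟩ hd
    have h1 : ε * ∑ i, ‖x i‖ ^ 2 ≤ |φ c| + 1 := by
      rw [Finset.mul_sum]
      calc _ ≤ ∑ i, φ (b (x i) (x i)) := Finset.sum_le_sum fun i _ => hbound _
        _ ≤ φ c + 1 := by simpa using hd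
        _ ≤ _ := by linarith [le_abs_self (φ c)]
    have h2 : ∑ i, ‖x i‖ ^ 2 ≤ (|φ c| + 1) / ε := by
      rw [le_div_iff₀ hε]
      linarith
    have h3 : (|φ c| + 1) / ε = ∑ i, ‖x i‖ ^ 2 + ((|φ c| + 1) / ε - ∑ i, ‖x i‖ ^ 2) := by ring
    rw [h3, (convex_convexHull ℝ _).add_smul (Finset.sum_nonneg fun i _ => sq_nonneg _)
      (sub_nonneg.2 h2), ← add_zero (∑ i, b (x i) (x i))]
    exact Set.add_mem_add (sum_quad_mem_smul b x) ⟨0, h0K, by simp⟩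
  have hcl : IsClosed (((|φ c| + 1) / ε) • K) :=
    ((isCompact_convexHull_quad_ball b).smul _).isClosed
  have hc' : c ∈ closure (quadCone b ∩ {d | φ d < φ c + 1}) := by
    rw [mem_closure_iff] at hc ⊢
    intro o ho hco
    obtain ⟨d, ⟨hd1, hd2⟩, hd3⟩ := hc (o ∩ {d | φ d < φ c + 1})
      (ho.inter (isOpen_lt hφc continuous_const)) ⟨hco, by simp⟩
    exact ⟨d, hd1, hd3, hd2⟩
  have hmem : c ∈ ((|φ c| + 1) / ε) • K :=
    closure_minimal (fun d hd => hbd d hd.1 (le_of_lt hd.2)) hcl hc'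
  obtain ⟨k, hk, hkc⟩ := hmem
  rw [← hkc]
  exact smul_mem_quadCone b (hKC hk) (by positivity)

theorem exists_separating_of_normed (φ : V →ₗ[ℝ] ℝ) (hφ : ∀ x, x ≠ 0 → 0 < φ (b x x)) {p : V}
    (hp : p ∉ quadCone b) : ∃ f : V →ₗ[ℝ] ℝ, (∀ x, 0 ≤ f (b x x)) ∧ f p < 0 := by
  obtain ⟨f, u, hfp, hf⟩ := geometric_hahn_banach_point_closed (convex_quadCone b)
    (isClosed_quadCone b φ hφ) hp
  have hu : u < 0 := by simpa using hf 0 (zero_mem_quadCone b)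
  refine ⟨f.toLinearMap, fun x => ?_, hfp.trans hu⟩
  by_contra hneg
  simp only [ContinuousLinearMap.coe_coe, not_le] at hneg
  -- A negative value could be rescaled inside the cone to equal the separating level `u`, where the
  -- inequality is strict.
  have h1 := hf ((u / f (b x x)) • b x x)
    (smul_mem_quadCone b (mem_quadCone_self b x) (div_nonneg_of_nonpos hu.le hneg.le))
  rw [map_smul, smul_eq_mul, div_mul_cancel₀ _ hneg.ne] at h1
  exact lt_irrefl _ h1

end Topological

/-- A vector outside the finite sums of values of a quadratic map on a finite-dimensional space is
strictly separated from them, if some functional is positive on the nonzero values. -/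
theorem exists_separating {W V : Type*} [AddCommGroup W] [Module ℝ W] [FiniteDimensional ℝ W]
    [AddCommGroup V] [Module ℝ V] (b : W →ₗ[ℝ] W →ₗ[ℝ] V) (φ : V →ₗ[ℝ] ℝ)
    (hφ : ∀ x, x ≠ 0 → 0 < φ (b x x)) {p : V} (hp : p ∉ quadCone b) :
    ∃ f : V →ₗ[ℝ] ℝ, (∀ x, 0 ≤ f (b x x)) ∧ f p < 0 := by
  -- `V` may be infinite-dimensional and neither space carries a norm. All values of `b`, together
  -- with `p`, lie in this finite-dimensional subspace, so the problem is transported to coordinate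
  -- spaces.
  let V' : Submodule ℝ V := LinearMap.range (TensorProduct.lift b) ⊔ Submodule.span ℝ {p}
  have : FiniteDimensional ℝ V' := inferInstance
  have hbV : ∀ x y, b x y ∈ V' := fun x y =>
    Submodule.mem_sup_left ⟨x ⊗ₜ[ℝ] y, TensorProduct.lift.tmul x y⟩
  have hpV : p ∈ V' := Submodule.mem_sup_right (Submodule.mem_span_singleton_self p)
  obtain ⟨π, hπ⟩ := V'.subtype.exists_leftInverse_of_injective (by simp)
  let eV := (Module.finBasis ℝ V').equivFun
  let eW := (Module.finBasis ℝ W).equivFun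
  let j : V →ₗ[ℝ] (Fin (Module.finrank ℝ V') → ℝ) := eV.toLinearMap ∘ₗ π
  let s : (Fin (Module.finrank ℝ V') → ℝ) →ₗ[ℝ] V := V'.subtype ∘ₗ eV.symm.toLinearMap
  have hsj : ∀ v ∈ V', s (j v) = v := by
    intro v hv
    have : π v = ⟨v, hv⟩ := LinearMap.congr_fun hπ ⟨v, hv⟩
    simp [s, j, this]
  let b' := (b.compl₁₂ eW.symm.toLinearMap eW.symm.toLinearMap).compr₂ j
  have hb' : ∀ x y, b' x y = j (b (eW.symm x) (eW.symm y)) := fun x y => by simp [b']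
  obtain ⟨f, hf, hfp⟩ := exists_separating_of_normed b' (φ ∘ₗ s) (p := j p) (fun x hx => by
    rw [hb', LinearMap.comp_apply, hsj _ (hbV _ _)]
    exact hφ _ (by simpa using hx)) (by
    rintro ⟨N, x, hx⟩
    apply hp
    refine ⟨N, fun i => eW.symm (x i), ?_⟩
    have := congrArg s hx
    rw [hsj p hpV, map_sum] at this
    rw [this]
    refine Finset.sum_congr rfl fun i _ => ?_
    rw [hb', hsj _ (hbV _ _)])
  refine ⟨f ∘ₗ j, fun x => ?_, hfp⟩
  have := hf (eW x)
  rw [hb'] at this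
  simpa using this

end Separation

/-! ### Truncated GNS construction -/

section GNS

variable {g ℓ : ℕ}

theorem exists_orthonormal_basis_of_posDef {V : Type*} [AddCommGroup V] [Module ℝ V]
    [FiniteDimensional ℝ V] (B : V →ₗ[ℝ] V →ₗ[ℝ] ℝ) (hB : ∀ x y, B x y = B y x)
    (hpos : ∀ x, x ≠ 0 → 0 < B x x) :
    ∃ (n : ℕ) (b : Fin n → V), (∀ i j, B (b i) (b j) = if i = j then 1 else 0) ∧
      ∀ x, x = ∑ i, B (b i) x • b i := by
  obtain ⟨v, hv⟩ := LinearMap.BilinForm.exists_orthogonal_basis (B := B) ⟨hB⟩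
  have hvpos : ∀ i, 0 < B (v i) (v i) := fun i => hpos _ (v.ne_zero i)
  have hortho : ∀ i j, i ≠ j → B (v i) (v j) = 0 := fun i j hij => hv hij
  refine ⟨_, fun i => (Real.sqrt (B (v i) (v i)))⁻¹ • v i, fun i j => ?_, fun x => ?_⟩
  · simp only [map_smul, LinearMap.smul_apply, smul_eq_mul]
    split_ifs with h
    · subst h
      have h1 := Real.mul_self_sqrt (hvpos i).le
      have h2 : Real.sqrt (B (v i) (v i)) ≠ 0 := (Real.sqrt_pos.2 (hvpos i)).ne'
      field_simp
      rw [sq, h1]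
    · simp [hortho i j h]
  · have h1 : ∀ i, B (v i) x = v.repr x i * B (v i) (v i) := by
      intro i
      conv_lhs => rw [← v.sum_repr x]
      rw [map_sum, Finset.sum_eq_single i]
      · simp
      · intro j _ hj
        simp [hortho i j hj.symm]
      · simp
    conv_lhs => rw [← v.sum_repr x]
    refine Finset.sum_congr rfl fun i _ => ?_
    have h2 := Real.mul_self_sqrt (hvpos i).le
    have h3 : Real.sqrt (B (v i) (v i)) ≠ 0 := (Real.sqrt_pos.2 (hvpos i)).ne'
    simp only [map_smul, LinearMap.smul_apply, smul_eq_mul, h1, smul_smul]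
    congr 1
    field_simp
    rw [sq, h2]

/-- The form on rows of polynomials induced by a functional on matrices of polynomials. -/
noncomputable def rowForm (lam : NCMat g ℓ ℓ →ₗ[ℝ] ℝ) : NCMat g 1 ℓ →ₗ[ℝ] NCMat g 1 ℓ →ₗ[ℝ] ℝ :=
  LinearMap.mk₂ ℝ (fun r s => lam (rᴴ * s))
    (fun r r' s => by rw [Matrix.conjTranspose_add, Matrix.add_mul, map_add])
    (fun c r s => by
      rw [Matrix.conjTranspose_smul, star_trivial, Matrix.smul_mul, map_smul])
    (fun r s s' => by rw [Matrix.mul_add, map_add])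
    (fun c r s => by rw [Matrix.mul_smul, map_smul])

theorem rowForm_apply (lam : NCMat g ℓ ℓ →ₗ[ℝ] ℝ) (r s : NCMat g 1 ℓ) :
    rowForm lam r s = lam (rᴴ * s) := rfl

theorem rowForm_comm {lam : NCMat g ℓ ℓ →ₗ[ℝ] ℝ} (hlam : ∀ m, lam mᴴ = lam m)
    (r s : NCMat g 1 ℓ) : rowForm lam r s = rowForm lam s r := by
  rw [rowForm_apply, rowForm_apply, ← hlam, Matrix.conjTranspose_mul,
    Matrix.conjTranspose_conjTranspose]

/-- Left multiplications by `f` and `star f` are adjoint; in an orthonormal basis the compressions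
of `x_i` and `x_i*` thus become transposes of each other. -/
theorem rowForm_smul_right (lam : NCMat g ℓ ℓ →ₗ[ℝ] ℝ) (f : NCPoly g) (r s : NCMat g 1 ℓ) :
    rowForm lam r (f • s) = rowForm lam (star f • r) s := by
  rw [rowForm_apply, rowForm_apply]
  congr 1
  ext i j
  simp [Matrix.mul_apply, mul_assoc]

/-- The `i`-th row of a matrix of polynomials. -/
def rowAt {ν : ℕ} (U : NCMat g ν ℓ) (i : Fin ν) : NCMat g 1 ℓ := Matrix.of fun _ => U i

/-- Expresses functionals of `U* M U` through `rowForm`. It serves for `M` the pencil, giving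
positivity, and for `U = 1`, giving the value at `p`. -/
theorem conjTranspose_mul_mul_eq_sum {ν : ℕ} (M : NCMat g ν ν) (U : NCMat g ν ℓ) :
    Uᴴ * M * U = ∑ i, ∑ j, (rowAt U i)ᴴ * (M i j • rowAt U j) := by
  ext k m
  simp only [Matrix.mul_apply, Matrix.sum_apply, Finset.sum_mul, rowAt, Matrix.conjTranspose_apply,
    Matrix.smul_apply, Matrix.of_apply, Finset.univ_unique, Finset.sum_const, Finset.card_singleton,
    one_smul, smul_eq_mul, mul_assoc]
  exact Finset.sum_comm

/-- Rows with entries of degree less than `d`. -/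
noncomputable def boundedRow (g ℓ d : ℕ) : (Fin ℓ → NCPoly.degLT g d) →ₗ[ℝ] NCMat g 1 ℓ where
  toFun f := Matrix.of fun _ j => (f j : NCPoly g)
  map_add' _ _ := rfl
  map_smul' _ _ := rfl

/-- Square matrices with entries of degree less than `d`. -/
noncomputable def boundedMat (g ℓ d : ℕ) :
    (Fin ℓ → Fin ℓ → NCPoly.degLT g d) →ₗ[ℝ] NCMat g ℓ ℓ where
  toFun f := Matrix.of fun i j => (f i j : NCPoly g)
  map_add' _ _ := rfl
  map_smul' _ _ := rfl

theorem boundedRow_single {d : ℕ} (j : Fin ℓ) (f : NCPoly.degLT g d) :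
    boundedRow g ℓ d (Pi.single j f) = (f : NCPoly g) • rowAt (1 : NCMat g ℓ ℓ) j := by
  ext i k
  change ((Pi.single j f : Fin ℓ → NCPoly.degLT g d) k : NCPoly g) =
    (f : NCPoly g) * (1 : NCMat g ℓ ℓ) j k
  by_cases h : j = k
  · subst h
    simp
  · simp [h]

/-- The letters act by compressions of left multiplication to the bounded rows. Compression is exact
where it matters: the quadratic form of the pencil involves a single letter between bounded rows,
and words of length at most `d` applied to the unit rows never leave the bounded rows. Positive
definiteness makes a quotient by null vectors unnecessary. -/
theorem exists_gns {A : Fin g ⊕ Fin g → Matrix (Fin ℓ) (Fin ℓ) ℝ} (hA : ∀ a, A a.swap = (A a)ᵀ)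
    {d : ℕ} {lam : NCMat g ℓ ℓ →ₗ[ℝ] ℝ} (hlam : ∀ m, lam mᴴ = lam m)
    (hpos : ∀ f, f ≠ 0 → 0 < rowForm lam (boundedRow g ℓ (d + 1) f) (boundedRow g ℓ (d + 1) f))
    (hpen : ∀ U, 0 ≤ lam ((boundedMat g ℓ (d + 1) U)ᴴ * pencil A * boundedMat g ℓ (d + 1) U)) :
    ∃ (n : ℕ) (X : MatTuple g n) (v : Fin ℓ × Fin n → ℝ), (evalMat (pencil A) X).PosSemidef ∧
      ∀ p : NCMat g ℓ ℓ, (∀ i j, p i j ∈ NCPoly.degLT g (d + 1)) →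
        v ⬝ᵥ (evalMat p X *ᵥ v) = lam p := by
  set R := boundedRow g ℓ (d + 1)
  obtain ⟨n, b, hb, hexp⟩ := exists_orthonormal_basis_of_posDef ((rowForm lam).compl₁₂ R R)
    (fun x y => rowForm_comm hlam _ _) hpos
  simp only [LinearMap.compl₁₂_apply] at hb hexp
  set c : NCMat g 1 ℓ →ₗ[ℝ] (Fin n → ℝ) := LinearMap.pi fun k => rowForm lam (R (b k)) with hc
  have hcapp : ∀ r k, c r k = rowForm lam (R (b k)) r := fun r k => rfl
  have hexpR : ∀ f, R f = ∑ k, c (R f) k • R (b k) := by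
    intro f
    conv_lhs => rw [hexp f]
    rw [map_sum]
    exact Finset.sum_congr rfl fun k _ => map_smul _ _ _
  let X : MatTuple g n := fun i => Matrix.of fun k m =>
    rowForm lam (R (b k)) (NCPoly.letter (Sum.inl i) • R (b m))
  have hX : ∀ a k m, evalPoly X (NCPoly.letter a) k m =
      rowForm lam (R (b k)) (NCPoly.letter a • R (b m)) := by
    rintro (i | i) k m
    · rw [evalPoly_letter]
      rfl
    · rw [evalPoly_letter, rowForm_smul_right, rowForm_comm hlam, NCPoly.star_letter]
      rfl
  -- Parseval needs only one of the two arguments in the bounded space, as `r` is seen only through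
  -- its projection.
  have hpars : ∀ f r, rowForm lam (R f) r = ∑ k, c (R f) k * c r k := by
    intro f r
    conv_lhs => rw [hexpR f]
    rw [map_sum, LinearMap.sum_apply]
    exact Finset.sum_congr rfl fun k _ => by rw [map_smul]; rfl
  refine ⟨n, X, fun jk => c (rowAt 1 jk.1) jk.2, ?_, ?_⟩
  · refine Matrix.PosSemidef.of_dotProduct_mulVec_nonneg ?_ fun z => ?_
    · rw [Matrix.IsHermitian, Matrix.conjTranspose_eq_transpose_of_trivial]
      exact evalMat_pencil_transpose A hA X
    · let U : Fin ℓ → Fin ℓ → NCPoly.degLT g (d + 1) := fun i => ∑ k, z (i, k) • b k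
      have hU : ∀ i, rowAt (boundedMat g ℓ (d + 1) U) i = ∑ k, z (i, k) • R (b k) := by
        intro i
        have : rowAt (boundedMat g ℓ (d + 1) U) i = R (U i) := rfl
        rw [this, map_sum]
        exact Finset.sum_congr rfl fun k _ => map_smul _ _ _
      have hent : ∀ i j k m, evalMat (pencil A) X (i, k) (j, m) =
          rowForm lam (R (b k)) (pencil A i j • R (b m)) := by
        intro i j k m
        simp only [evalMat_apply, pencil_apply, map_add, map_sum, map_smul, map_one,
          Matrix.add_apply, Matrix.sum_apply, Matrix.smul_apply, hX, add_smul, Finset.sum_smul,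
          smul_assoc, one_smul, Matrix.one_apply (i := k), hb]
      have key : star z ⬝ᵥ (evalMat (pencil A) X *ᵥ z) =
          lam ((boundedMat g ℓ (d + 1) U)ᴴ * pencil A * boundedMat g ℓ (d + 1) U) := by
        rw [conjTranspose_mul_mul_eq_sum, map_sum]
        simp only [map_sum, ← rowForm_apply, hU, star_trivial, dotProduct, Matrix.mulVec,
          Fintype.sum_prod_type, Finset.smul_sum, LinearMap.sum_apply, map_smul,
          LinearMap.smul_apply, hent, smul_comm _ (z _), smul_eq_mul, Finset.mul_sum]
        refine Finset.sum_congr rfl fun i _ => ?_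
        rw [Finset.sum_comm]
        refine Finset.sum_congr rfl fun j _ => ?_
        rw [Finset.sum_comm]
        refine Finset.sum_congr rfl fun k _ => ?_
        refine Finset.sum_congr rfl fun m _ => ?_
        ring
      rw [key]
      exact hpen U
  · intro p hp
    have hrow : ∀ j, rowAt (1 : NCMat g ℓ ℓ) j =
        R (Pi.single j ⟨1, NCPoly.one_mem_degLT d⟩) := fun j => by
      rw [boundedRow_single, one_smul]
    have hword : ∀ (j : Fin ℓ) (w : List (Fin g ⊕ Fin g)), w.length < d + 1 →
        evalPoly X (NCPoly.word w) *ᵥ c (rowAt 1 j) = c (NCPoly.word w • rowAt 1 j) := by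
      intro j w
      induction w with
      | nil => simp
      | cons a w ih =>
        intro hw
        simp only [List.length_cons] at hw
        obtain ⟨f, hf⟩ : ∃ f, NCPoly.word w • rowAt (1 : NCMat g ℓ ℓ) j = R f := by
          refine ⟨Pi.single j ⟨NCPoly.word w, NCPoly.word_mem_degLT (by omega)⟩, ?_⟩
          rw [boundedRow_single]
        rw [NCPoly.word_cons, map_mul, ← Matrix.mulVec_mulVec, ih (by omega), mul_smul, hf]
        funext k
        conv_rhs => rw [hexpR f]
        simp only [Matrix.mulVec, dotProduct, hX, hcapp, Finset.smul_sum, map_sum,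
          smul_comm (NCPoly.letter a) (_ : ℝ), map_smul, smul_eq_mul, mul_comm]
    have hpoly : ∀ (j : Fin ℓ) (f : NCPoly g), f ∈ NCPoly.degLT g (d + 1) →
        evalPoly X f *ᵥ c (rowAt 1 j) = c (f • rowAt 1 j) := by
      intro j f hf
      rw [NCPoly.degLT_eq_span] at hf
      induction hf using Submodule.span_induction with
      | mem x hx =>
        obtain ⟨w, hw, rfl⟩ := hx
        exact hword j w hw
      | zero => simp
      | add x y _ _ hx hy => rw [map_add, Matrix.add_mulVec, hx, hy, add_smul, map_add]
      | smul r x _ hx => rw [map_smul, Matrix.smul_mulVec, hx, smul_assoc, LinearMap.map_smul c r]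
    have hsum := conjTranspose_mul_mul_eq_sum p (1 : NCMat g ℓ ℓ)
    rw [Matrix.conjTranspose_one, Matrix.one_mul, Matrix.mul_one] at hsum
    conv_rhs => rw [hsum]
    simp only [map_sum, ← rowForm_apply]
    simp only [dotProduct, Fintype.sum_prod_type]
    refine Finset.sum_congr rfl fun i _ => ?_
    have h1 : ∀ k, (evalMat p X *ᵥ fun jk => c (rowAt 1 jk.1) jk.2) (i, k) =
        ∑ j, c (p i j • rowAt 1 j) k := by
      intro k
      simp only [← hpoly _ _ (hp _ _), Matrix.mulVec, dotProduct, Fintype.sum_prod_type,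
        evalMat_apply]
    simp only [h1, Finset.mul_sum]
    rw [Finset.sum_comm]
    refine Finset.sum_congr rfl fun j _ => ?_
    rw [hrow i, hpars]

end GNS

/-! ### The convex Positivstellensatz -/

section Positivstellensatz

variable {g ℓ : ℕ}

/-- At a faithful tuple where the pencil is positive definite, `p(X)` is positive semidefinite and
hence symmetric; so `pᴴ - p` evaluates to zero there and is zero. -/
theorem eq_conjTranspose_of_posDomain_subset {A : Fin g ⊕ Fin g → Matrix (Fin ℓ) (Fin ℓ) ℝ}
    (hA : ∀ a, A a.swap = (A a)ᵀ) {p : NCMat g ℓ ℓ}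
    (hp : ∀ n, posDomain (pencil A) n ⊆ posDomain p n) : pᴴ = p := by
  obtain ⟨d, hd⟩ := NCPoly.exists_forall_mem_degLT fun ij : Fin ℓ × Fin ℓ => (pᴴ - p) ij.1 ij.2
  obtain ⟨n, X, hX, hpd⟩ := exists_faithful_posDef A hA d
  have h1 : (evalMat p X).PosSemidef := hp n hpd.posSemidef
  have h2 : (evalMat p X)ᵀ = evalMat p X := by
    rw [← Matrix.conjTranspose_eq_transpose_of_trivial]
    exact h1.isHermitian
  ext i j
  rw [← sub_eq_zero, ← Matrix.sub_apply]
  refine hX _ (hd (i, j)) ?_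
  ext k m
  rw [Matrix.sub_apply, map_sub, Matrix.sub_apply, ← evalMat_apply, ← evalMat_apply,
    evalMat_conjTranspose, h2, sub_self]
  rfl

/-- The quadratic map whose values generate the truncated quadratic module of `L`. -/
noncomputable def moduleForm (L : NCMat g ℓ ℓ) (d : ℕ) :
    ((Fin ℓ → NCPoly.degLT g d) × (Fin ℓ → Fin ℓ → NCPoly.degLT g d)) →ₗ[ℝ]
    ((Fin ℓ → NCPoly.degLT g d) × (Fin ℓ → Fin ℓ → NCPoly.degLT g d)) →ₗ[ℝ] NCMat g ℓ ℓ :=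
  LinearMap.mk₂ ℝ (fun x y => (boundedRow g ℓ d x.1)ᴴ * boundedRow g ℓ d y.1 +
      (boundedMat g ℓ d x.2)ᴴ * L * boundedMat g ℓ d y.2)
    (fun x x' y => by
      simp only [Prod.fst_add, Prod.snd_add, map_add, Matrix.conjTranspose_add, Matrix.add_mul]
      abel)
    (fun c x y => by
      simp only [Prod.smul_fst, Prod.smul_snd, map_smul, Matrix.conjTranspose_smul, star_trivial,
        Matrix.smul_mul, smul_add])
    (fun x y y' => by
      simp only [Prod.fst_add, Prod.snd_add, map_add, Matrix.mul_add]
      abel)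
    (fun c x y => by
      simp only [Prod.smul_fst, Prod.smul_snd, map_smul, Matrix.mul_smul, smul_add])

theorem moduleForm_apply (L : NCMat g ℓ ℓ) (d : ℕ)
    (x y : (Fin ℓ → NCPoly.degLT g d) × (Fin ℓ → Fin ℓ → NCPoly.degLT g d)) :
    moduleForm L d x y = (boundedRow g ℓ d x.1)ᴴ * boundedRow g ℓ d y.1 +
      (boundedMat g ℓ d x.2)ᴴ * L * boundedMat g ℓ d y.2 := rfl

theorem evalMat_eq_zero_of_faithful {ν n d : ℕ} {X : MatTuple g n}
    (hX : ∀ f ∈ NCPoly.degLT g d, evalPoly X f = 0 → f = 0) {f : NCMat g ν ℓ}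
    (hf : ∀ i j, f i j ∈ NCPoly.degLT g d) (h : evalMat f X = 0) : f = 0 := by
  ext i j
  refine hX _ (hf i j) ?_
  ext k m
  rw [← evalMat_apply, h]
  rfl

/-- A strictly positive symmetric functional on the truncated quadratic module. -/
theorem exists_positive_functional {A : Fin g ⊕ Fin g → Matrix (Fin ℓ) (Fin ℓ) ℝ}
    (hA : ∀ a, A a.swap = (A a)ᵀ) (d : ℕ) :
    ∃ φ : NCMat g ℓ ℓ →ₗ[ℝ] ℝ, (∀ m, φ mᴴ = φ m) ∧
      ∀ x, x ≠ 0 → 0 < φ (moduleForm (pencil A) d x x) := by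
  obtain ⟨n, X, hX, hpd⟩ := exists_faithful_posDef A hA d
  -- The trace at a faithful tuple with `L(X) ≻ 0`. If it vanishes on a square plus a weighted
  -- square, both evaluations are zero, and faithfulness makes both matrices of polynomials zero.
  let φ : NCMat g ℓ ℓ →ₗ[ℝ] ℝ :=
    { toFun := fun m => (evalMat m X).trace
      map_add' := fun p q => by rw [evalMat_add, Matrix.trace_add]
      map_smul' := fun c p => by rw [evalMat_smul, Matrix.trace_smul]; rfl }
  refine ⟨φ, fun m => ?_, fun x hx => ?_⟩
  · change (evalMat mᴴ X).trace = (evalMat m X).trace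
    rw [evalMat_conjTranspose, Matrix.trace_transpose]
  · have h1 : φ (moduleForm (pencil A) d x x) =
        ((evalMat (boundedRow g ℓ d x.1) X)ᴴ * evalMat (boundedRow g ℓ d x.1) X).trace +
        ((evalMat (boundedMat g ℓ d x.2) X)ᴴ * evalMat (pencil A) X *
          evalMat (boundedMat g ℓ d x.2) X).trace := by
      change (evalMat _ X).trace = _
      rw [moduleForm_apply, evalMat_add, evalMat_mul, evalMat_mul, evalMat_mul,
        evalMat_conjTranspose, evalMat_conjTranspose, Matrix.trace_add,
        Matrix.conjTranspose_eq_transpose_of_trivial, Matrix.conjTranspose_eq_transpose_of_trivial]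
    have p1 := Matrix.posSemidef_conjTranspose_mul_self (evalMat (boundedRow g ℓ d x.1) X)
    have p2 := hpd.posSemidef.conjTranspose_mul_mul_same (evalMat (boundedMat g ℓ d x.2) X)
    rw [h1]
    refine lt_of_le_of_ne (add_nonneg p1.trace_nonneg p2.trace_nonneg) fun h0 => hx ?_
    have h2 := (add_eq_zero_iff_of_nonneg p1.trace_nonneg p2.trace_nonneg).1 h0.symm
    have e1 : evalMat (boundedRow g ℓ d x.1) X = 0 :=
      Matrix.trace_conjTranspose_mul_self_eq_zero_iff.1 h2.1
    have e2 : evalMat (boundedMat g ℓ d x.2) X = 0 := by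
      have h3 := p2.trace_eq_zero_iff.1 h2.2
      ext i k
      by_contra hne
      have hcol : (fun i => evalMat (boundedMat g ℓ d x.2) X i k) ≠ 0 := fun h =>
        hne (by simpa using congrFun h i)
      have h4 := hpd.dotProduct_mulVec_pos hcol
      have h5 := congrFun (congrFun h3 k) k
      rw [Matrix.mul_assoc] at h5
      exact h4.ne' h5
    have f1 := evalMat_eq_zero_of_faithful hX (fun i j => (x.1 j).2) e1
    have f2 := evalMat_eq_zero_of_faithful hX (fun i j => (x.2 i j).2) e2
    refine Prod.ext (funext fun j => Subtype.ext ?_) (funext fun i => funext fun j => Subtype.ext ?_)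
    · exact congrFun (congrFun f1 0) j
    · exact congrFun (congrFun f2 i) j

/-- **Convex Positivstellensatz.** A polynomial that is positive semidefinite on the positivity
domain of a monic pencil lies in the quadratic module of the pencil. -/
theorem exists_sum_of_squares {A : Fin g ⊕ Fin g → Matrix (Fin ℓ) (Fin ℓ) ℝ}
    (hA : ∀ a, A a.swap = (A a)ᵀ) {p : NCMat g ℓ ℓ}
    (hp : ∀ n, posDomain (pencil A) n ⊆ posDomain p n) :
    ∃ (N : ℕ) (q : Fin N → NCMat g 1 ℓ) (U : Fin N → NCMat g ℓ ℓ),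
      p = ∑ i, ((q i)ᴴ * q i + (U i)ᴴ * pencil A * U i) := by
  obtain ⟨d, hd⟩ := NCPoly.exists_forall_mem_degLT fun ij : Fin ℓ × Fin ℓ => p ij.1 ij.2
  -- The bound `d + 1` instead of `d` ensures that the bounded rows contain the constants, from
  -- which the GNS vector is built.
  by_cases hmem : p ∈ quadCone (moduleForm (pencil A) (d + 1))
  · obtain ⟨N, x, hx⟩ := hmem
    exact ⟨N, fun i => boundedRow g ℓ (d + 1) (x i).1, fun i => boundedMat g ℓ (d + 1) (x i).2, hx⟩
  exfalso
  obtain ⟨φ, hφs, hφ⟩ := exists_positive_functional hA (d + 1)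
  obtain ⟨f, hf, hfp⟩ := exists_separating _ φ hφ hmem
  have hpp := eq_conjTranspose_of_posDomain_subset hA hp
  -- The separating `f` need be neither symmetric nor strictly positive. Adding `f ∘ st` and a small
  -- multiple of `φ` repairs both; the factor `2` appears because `p` is symmetric.
  obtain ⟨ε, hε, hεp⟩ : ∃ ε > 0, 2 * f p + ε * φ p < 0 := by
    have h0 : 0 < |φ p| + 1 := by positivity
    refine ⟨-f p / (|φ p| + 1), div_pos (by linarith) h0, ?_⟩
    have h1 : -f p / (|φ p| + 1) * φ p ≤ -f p := by
      rw [div_mul_eq_mul_div, div_le_iff₀ h0]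
      nlinarith [le_abs_self (φ p)]
    linarith
  let st : NCMat g ℓ ℓ →ₗ[ℝ] NCMat g ℓ ℓ :=
    { toFun := fun m => mᴴ
      map_add' := Matrix.conjTranspose_add
      map_smul' := fun c m => by rw [Matrix.conjTranspose_smul, star_trivial]; rfl }
  let lam : NCMat g ℓ ℓ →ₗ[ℝ] ℝ := f + f ∘ₗ st + ε • φ
  have hlam : ∀ m, lam m = f m + f mᴴ + ε * φ m := fun m => rfl
  have hsq : ∀ x, lam (moduleForm (pencil A) (d + 1) x x) =
      2 * f (moduleForm (pencil A) (d + 1) x x) +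
        ε * φ (moduleForm (pencil A) (d + 1) x x) := by
    intro x
    have : (moduleForm (pencil A) (d + 1) x x)ᴴ = moduleForm (pencil A) (d + 1) x x := by
      simp [moduleForm_apply, Matrix.conjTranspose_mul, pencil_conjTranspose A hA, Matrix.mul_assoc]
    rw [hlam, this]
    ring
  obtain ⟨n, X, v, hX, hv⟩ := exists_gns hA (d := d) (lam := lam)
    (fun m => by
      rw [hlam, hlam, Matrix.conjTranspose_conjTranspose, hφs]
      ring)
    (fun r hr => by
      have h1 := hsq (r, 0)
      have h2 : moduleForm (pencil A) (d + 1) (r, 0) (r, 0) =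
          (boundedRow g ℓ (d + 1) r)ᴴ * boundedRow g ℓ (d + 1) r := by
        simp [moduleForm_apply]
      have h3 := hφ (r, 0) (by simpa using hr)
      rw [rowForm_apply, ← h2, h1]
      have := hf (r, 0)
      positivity)
    (fun U => by
      have h1 := hsq (0, U)
      have h2 : moduleForm (pencil A) (d + 1) (0, U) (0, U) =
          (boundedMat g ℓ (d + 1) U)ᴴ * pencil A * boundedMat g ℓ (d + 1) U := by
        simp [moduleForm_apply]
      rw [← h2, h1]
      have h3 := hf (0, U)
      have h4 : 0 ≤ φ (moduleForm (pencil A) (d + 1) (0, U) (0, U)) := by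
        rcases eq_or_ne U 0 with rfl | hU
        · simp [moduleForm_apply]
        · exact (hφ (0, U) (by simpa using hU)).le
      positivity)
  have h1 := hv p fun i j => NCPoly.degLT_mono (Nat.le_succ d) (hd (i, j))
  have h2 : (evalMat p X).PosSemidef := hp n hX
  have h3 := h2.dotProduct_mulVec_nonneg v
  rw [star_trivial, h1, hlam, hpp] at h3
  linarith

end Positivstellensatz

/-! ### Pseudoinverse of the Gram matrix and support projection of a pencil -/

section PseudoInverse

/-- Invert the eigenvalues in an orthonormal eigenbasis; the convention `0⁻¹ = 0` takes care of the
kernel. -/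
theorem Matrix.exists_pseudoInverse {n : Type*} [Fintype n] [DecidableEq n] (Q : Matrix n n ℝ)
    (hQ : Qᵀ = Q) : ∃ R : Matrix n n ℝ, Rᵀ = R ∧ R * Q = Q * R ∧ Q * R * Q = Q := by
  have hH : Q.IsHermitian := by
    rw [Matrix.IsHermitian, Matrix.conjTranspose_eq_transpose_of_trivial, hQ]
  set U : Matrix n n ℝ := ↑hH.eigenvectorUnitary
  set e := hH.eigenvalues
  have h1 : Uᵀ * U = 1 := by
    rw [← Matrix.conjTranspose_eq_transpose_of_trivial]
    exact Unitary.coe_star_mul_self hH.eigenvectorUnitary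
  have hspec : Q = U * Matrix.diagonal e * Uᵀ := by
    have := hH.spectral_theorem
    rw [Unitary.conjStarAlgAut_apply] at this
    rw [← Matrix.conjTranspose_eq_transpose_of_trivial]
    exact this
  have hmul : ∀ a b : n → ℝ, (U * Matrix.diagonal a * Uᵀ) * (U * Matrix.diagonal b * Uᵀ) =
      U * Matrix.diagonal (fun i => a i * b i) * Uᵀ := by
    intro a b
    calc _ = U * Matrix.diagonal a * (Uᵀ * U) * Matrix.diagonal b * Uᵀ := by
          simp only [Matrix.mul_assoc]
      _ = _ := by rw [h1, Matrix.mul_one, Matrix.mul_assoc U, Matrix.diagonal_mul_diagonal]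
  refine ⟨U * Matrix.diagonal (fun i => (e i)⁻¹) * Uᵀ, ?_, ?_, ?_⟩
  · simp [Matrix.transpose_mul, Matrix.mul_assoc]
  · rw [hspec, hmul, hmul]
    simp only [mul_comm]
  · rw [hspec, hmul, hmul]
    congr 3
    funext i
    rcases eq_or_ne (e i) 0 with h | h
    · simp [h]
    · field_simp

variable {g ℓ : ℕ}

/-- The sum of the squares of the coefficients of a pencil. -/
def gram (A : Fin g ⊕ Fin g → Matrix (Fin ℓ) (Fin ℓ) ℝ) : Matrix (Fin ℓ) (Fin ℓ) ℝ :=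
  ∑ a, A a * (A a)ᵀ

/-- `P` is the orthogonal projection onto the complement of the common kernel of the coefficients,
and `R` inverts the Gram matrix there. -/
structure PencilSupport (A : Fin g ⊕ Fin g → Matrix (Fin ℓ) (Fin ℓ) ℝ)
    (R P : Matrix (Fin ℓ) (Fin ℓ) ℝ) : Prop where
  swap : ∀ a, A a.swap = (A a)ᵀ
  transpose_R : Rᵀ = R
  transpose_P : Pᵀ = P
  R_mul_gram : R * gram A = P
  gram_mul_R : gram A * R = P
  mul_P : ∀ a, A a * P = A a
  P_mul : ∀ a, P * A a = A a

/-- With `P = R * gram A`, the squares of the matrices `(A a)ᵀ * (1 - P)` add up to `(1 - P) * gram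
A * (1 - P) = 0`, and taking traces kills each of them. Closure of the coefficients under
transposition gives the identity on the other side. -/
theorem exists_pencilSupport {A : Fin g ⊕ Fin g → Matrix (Fin ℓ) (Fin ℓ) ℝ}
    (hA : ∀ a, A a.swap = (A a)ᵀ) : ∃ R P, PencilSupport A R P := by
  have hQ : (gram A)ᵀ = gram A := by simp [gram, Matrix.transpose_sum, Matrix.transpose_mul]
  obtain ⟨R, hR, hcomm, hQRQ⟩ := Matrix.exists_pseudoInverse (gram A) hQ
  have hP : (R * gram A)ᵀ = R * gram A := by rw [Matrix.transpose_mul, hQ, hR, hcomm]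
  set P := R * gram A with hPdef
  have h0 : ∀ a, (A a)ᵀ * (1 - P) = 0 := by
    have hsum : ∑ a, ((A a)ᵀ * (1 - P))ᴴ * ((A a)ᵀ * (1 - P)) = 0 := by
      have : ∀ a, ((A a)ᵀ * (1 - P))ᴴ * ((A a)ᵀ * (1 - P)) =
          (1 - P) * (A a * (A a)ᵀ) * (1 - P) := by
        intro a
        rw [Matrix.conjTranspose_eq_transpose_of_trivial, Matrix.transpose_mul,
          Matrix.transpose_sub, hP, Matrix.transpose_one, Matrix.transpose_transpose]
        simp only [Matrix.mul_assoc]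
      simp only [this]
      rw [← Matrix.sum_mul, ← Matrix.mul_sum]
      change (1 - P) * gram A * (1 - P) = 0
      have : gram A * (1 - P) = 0 := by
        rw [Matrix.mul_sub, Matrix.mul_one, hPdef, ← Matrix.mul_assoc, hQRQ, sub_self]
      rw [Matrix.mul_assoc, this, Matrix.mul_zero]
    have htr := congrArg Matrix.trace hsum
    rw [Matrix.trace_sum, Matrix.trace_zero, Finset.sum_eq_zero_iff_of_nonneg fun a _ =>
      (Matrix.posSemidef_conjTranspose_mul_self _).trace_nonneg] at htr
    exact fun a => Matrix.trace_conjTranspose_mul_self_eq_zero_iff.1 (htr a (Finset.mem_univ a))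
  have h1 : ∀ a, A a * P = A a := by
    intro a
    have := h0 a.swap
    rw [hA, Matrix.transpose_transpose, Matrix.mul_sub, Matrix.mul_one, sub_eq_zero] at this
    exact this.symm
  refine ⟨R, P, hA, hR, hP, rfl, hcomm.symm, h1, fun a => ?_⟩
  have := congrArg Matrix.transpose (h1 a.swap)
  rwa [Matrix.transpose_mul, hP, hA, Matrix.transpose_transpose] at this

namespace PencilSupport

variable {A : Fin g ⊕ Fin g → Matrix (Fin ℓ) (Fin ℓ) ℝ} {R P : Matrix (Fin ℓ) (Fin ℓ) ℝ}

theorem P_mul_gram (h : PencilSupport A R P) : P * gram A = gram A := by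
  rw [gram, Matrix.mul_sum]
  exact Finset.sum_congr rfl fun a _ => by rw [← Matrix.mul_assoc, h.P_mul]

theorem P_mul_P (h : PencilSupport A R P) : P * P = P := by
  conv_lhs => rw [← h.gram_mul_R, ← Matrix.mul_assoc, h.gram_mul_R, h.P_mul_gram, h.gram_mul_R]

theorem constMat_comm (h : PencilSupport A R P) :
    (constMat P : NCMat g ℓ ℓ) * pencil A = pencil A * constMat P :=
  constMat_comm_pencil A fun a => by rw [h.mul_P, h.P_mul]

/-- The pencil is the identity on the common kernel of its coefficients. That part is therefore
trivially a multiple of the pencil, and division need only be done on the support `P`. -/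
theorem one_sub_mul_pencil (h : PencilSupport A R P) :
    (constMat (1 - P) : NCMat g ℓ ℓ) * pencil A = constMat (1 - P) := by
  have h0 : ∀ a, (1 - P) * A a = 0 := fun a => by
    rw [Matrix.sub_mul, Matrix.one_mul, h.P_mul, sub_self]
  rw [pencil, Matrix.mul_add, Matrix.mul_one, Matrix.mul_sum, Finset.sum_eq_zero, add_zero]
  intro a _
  rw [constMat_mul_tens, h0]
  ext
  simp [tens]

end PencilSupport

end PseudoInverse

/-! ### Explicit zeros of a pencil with a Fock space attached -/

section NullModel

variable {g ℓ : ℕ} {A : Fin g ⊕ Fin g → Matrix (Fin ℓ) (Fin ℓ) ℝ}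
  {R P : Matrix (Fin ℓ) (Fin ℓ) ℝ}

/-- The coefficients of a pencil, stacked. -/
def stacked (A : Fin g ⊕ Fin g → Matrix (Fin ℓ) (Fin ℓ) ℝ) :
    Matrix ((Fin g ⊕ Fin g) × Fin ℓ) (Fin ℓ) ℝ :=
  Matrix.of fun ak j => A ak.1 j ak.2

theorem stacked_transpose_mul : (stacked A)ᵀ * stacked A = gram A := by
  ext i j
  simp only [stacked, gram, Matrix.mul_apply, Matrix.transpose_apply, Matrix.of_apply,
    Matrix.sum_apply, Fintype.sum_prod_type]

theorem PencilSupport.stacked_mul_P (h : PencilSupport A R P) : stacked A * P = stacked A := by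
  ext ⟨a, k⟩ j
  have := congrFun (congrFun (h.P_mul a) j) k
  rw [Matrix.mul_apply] at this ⊢
  simp only [stacked, Matrix.of_apply]
  rw [← this]
  refine Finset.sum_congr rfl fun m _ => ?_
  have hs : P m j = P j m := congrFun (congrFun h.transpose_P j) m
  rw [hs, mul_comm]

/-- The degree-zero part of the letters in the model annihilated by a pencil. -/
def nullDiag (A : Fin g ⊕ Fin g → Matrix (Fin ℓ) (Fin ℓ) ℝ) (R : Matrix (Fin ℓ) (Fin ℓ) ℝ)
    (a : Fin g ⊕ Fin g) : Matrix ((Fin g ⊕ Fin g) × Fin ℓ) ((Fin g ⊕ Fin g) × Fin ℓ) ℝ :=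
  -(stacked A * R * A a * R * (stacked A)ᵀ)

theorem nullDiag_swap (h : PencilSupport A R P) (a : Fin g ⊕ Fin g) :
    nullDiag A R a.swap = (nullDiag A R a)ᵀ := by
  simp [nullDiag, h.swap, Matrix.transpose_mul, h.transpose_R, Matrix.mul_assoc]

/-- Explains the sign and the factors `R`: summing `-(stacked A * R * A a)` against `(A a)ᵀ` gives
`-(stacked A * P) = -stacked A`, which cancels the constant term of the pencil. -/
theorem nullDiag_mul_stacked (h : PencilSupport A R P) (a : Fin g ⊕ Fin g) :
    nullDiag A R a * stacked A = -(stacked A * R * A a) := by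
  rw [nullDiag, Matrix.neg_mul, Matrix.mul_assoc _ _ (stacked A), stacked_transpose_mul,
    Matrix.mul_assoc _ R, h.R_mul_gram, Matrix.mul_assoc _ (A a), h.mul_P]

/-- The letters of the model annihilated by a pencil. -/
noncomputable def nullModel (A : Fin g ⊕ Fin g → Matrix (Fin ℓ) (Fin ℓ) ℝ)
    (R : Matrix (Fin ℓ) (Fin ℓ) ℝ) (N : ℕ) (β : Fin g ⊕ Fin g → Fin ℓ → ℝ) :=
  fockModel N (nullDiag A R) fun a => (stacked A * R) *ᵥ β a

/-- The vectors of the model annihilated by a pencil. -/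
def nullVec (A : Fin g ⊕ Fin g → Matrix (Fin ℓ) (Fin ℓ) ℝ) (N : ℕ) (j : Fin ℓ) :
    (Fin g ⊕ Fin g) × Fin ℓ ⊕ BoundedWord g N → ℝ :=
  Sum.elim (fun x => stacked A x j) 0

theorem nullModel_swap (h : PencilSupport A R P) (N : ℕ) (β : Fin g ⊕ Fin g → Fin ℓ → ℝ)
    (a : Fin g ⊕ Fin g) : nullModel A R N β a.swap = (nullModel A R N β a)ᵀ :=
  fockModel_swap (nullDiag_swap h) a

/-- Since `stacked A` has Gram matrix `gram A`, the factor `R` makes the coupling functionals take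
the prescribed values on the vectors of the model, up to `P`. -/
theorem dotProduct_nullVec (h : PencilSupport A R P) (N : ℕ) (β : Fin ℓ → ℝ) (j : Fin ℓ) :
    ((stacked A * R) *ᵥ β) ⬝ᵥ (nullVec A N j ∘ Sum.inl) = (P *ᵥ β) j := by
  have h1 : (stacked A)ᵀ * (stacked A * R) = P := by
    rw [← Matrix.mul_assoc, stacked_transpose_mul, h.gram_mul_R]
  rw [← h1, ← Matrix.mulVec_mulVec β (stacked A)ᵀ, dotProduct_comm]
  rfl

variable {N : ℕ} {β : Fin g ⊕ Fin g → Fin ℓ → ℝ}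

theorem nullModel_mulVec_inl (a : Fin g ⊕ Fin g) (C : Fin ℓ → ℝ)
    (x : (Fin g ⊕ Fin g) × Fin ℓ) :
    (nullModel A R N β a *ᵥ ∑ j, C j • nullVec A N j) (Sum.inl x) =
      ((nullDiag A R a * stacked A) *ᵥ C) x := by
  rw [nullModel, fockModel_mulVec_inl]
  · have h1 : (∑ j, C j • nullVec A N j) ∘ Sum.inl = stacked A *ᵥ C := by
      funext y
      simp [nullVec, Matrix.mulVec, dotProduct, mul_comm]
    rw [h1, Matrix.mulVec_mulVec]
  · simp [nullVec]

theorem nullModel_mulVec_inr (h : PencilSupport A R P) (a : Fin g ⊕ Fin g) (C : Fin ℓ → ℝ)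
    (u : BoundedWord g N) :
    (nullModel A R N β a *ᵥ ∑ j, C j • nullVec A N j) (Sum.inr u) =
      vacuum g N u * ∑ j, C j * (P *ᵥ β a) j := by
  rw [nullModel, fockModel_mulVec_inr]
  have h1 : ∀ w, (∑ j, C j • nullVec A N j) (Sum.inr w) = 0 := by
    intro w
    simp [nullVec]
  have h2 : (∑ j, C j • nullVec A N j) ∘ Sum.inl =
      ∑ j, C j • ((nullVec A N j) ∘ Sum.inl) := by
    funext y
    simp
  simp only [h1, ite_self, Finset.sum_const_zero, add_zero, h2, dotProduct_sum, dotProduct_smul,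
    dotProduct_nullVec h, smul_eq_mul]

/-- The action of a pencil on constant combinations of the vectors of the model. -/
theorem act_pencil_nullVec_inl (C : Matrix (Fin ℓ) (Fin ℓ) ℝ) (i : Fin ℓ)
    (x : (Fin g ⊕ Fin g) × Fin ℓ) (h : PencilSupport A R P) :
    act (nullModel A R N β) (pencil A) (fun j => ∑ k, C j k • nullVec A N k) i (Sum.inl x) =
      (stacked A * (Cᵀ - R * ∑ a, A a * Cᵀ * (A a)ᵀ)) x i := by
  rw [act_pencil]
  simp only [Pi.add_apply, Finset.sum_apply, Pi.smul_apply, smul_eq_mul, nullModel_mulVec_inl,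
    nullDiag_mul_stacked h]
  rw [Matrix.mul_sub, Matrix.sub_apply, Matrix.mul_sum, Matrix.mul_sum, Matrix.sum_apply, sub_eq_add_neg,
    ← Finset.sum_neg_distrib]
  congr 1
  · simp [Matrix.mul_apply, nullVec, mul_comm]
  · refine Finset.sum_congr rfl fun a _ => ?_
    have h1 : stacked A * (R * (A a * Cᵀ * (A a)ᵀ)) = stacked A * R * A a * Cᵀ * (A a)ᵀ := by
      simp only [Matrix.mul_assoc]
    rw [h1, Matrix.mul_apply, ← Finset.sum_neg_distrib]
    refine Finset.sum_congr rfl fun j _ => ?_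
    rw [Matrix.neg_mulVec, Pi.neg_apply, Matrix.transpose_apply, Matrix.mul_apply, mul_neg,
      mul_comm]
    rfl

theorem act_pencil_nullVec_inr (h : PencilSupport A R P) (C : Matrix (Fin ℓ) (Fin ℓ) ℝ)
    (i : Fin ℓ) (u : BoundedWord g N) :
    act (nullModel A R N β) (pencil A) (fun j => ∑ k, C j k • nullVec A N k) i (Sum.inr u) =
      vacuum g N u * (∑ a, (A a * C * P) *ᵥ β a) i := by
  rw [act_pencil]
  simp only [Pi.add_apply, Finset.sum_apply, Pi.smul_apply, smul_eq_mul, nullModel_mulVec_inr h,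
    ← Matrix.mulVec_mulVec]
  simp only [nullVec, Sum.elim_inr, Pi.zero_apply, mul_zero, Finset.sum_const_zero, zero_add,
    Finset.mul_sum]
  refine Finset.sum_congr rfl fun a _ => ?_
  simp only [Matrix.mulVec, dotProduct, Finset.mul_sum]
  refine Finset.sum_congr rfl fun j _ => Finset.sum_congr rfl fun k _ =>
    Finset.sum_congr rfl fun m _ => ?_
  ring

/-- In `ℝ^H` the letters cancel the identity term. In the Fock part only the vacuum component can be
nonzero, and it equals `∑ A_a β_a`, because `A a * P = A a`. -/
theorem act_pencil_nullVec (h : PencilSupport A R P) (hβ : ∑ a, A a *ᵥ β a = 0) :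
    act (nullModel A R N β) (pencil A) (nullVec A N) = 0 := by
  have h0 : nullVec A N = fun j => ∑ k, (1 : Matrix (Fin ℓ) (Fin ℓ) ℝ) j k • nullVec A N k := by
    funext j
    simp [Matrix.one_apply]
  rw [h0]
  funext i
  ext x
  rcases x with x | u
  · rw [act_pencil_nullVec_inl 1 i x h]
    have : R * ∑ a, A a * (1 : Matrix (Fin ℓ) (Fin ℓ) ℝ)ᵀ * (A a)ᵀ = P := by
      simp only [Matrix.transpose_one, Matrix.mul_one]
      exact h.R_mul_gram
    rw [this, Matrix.mul_sub, h.stacked_mul_P, Matrix.transpose_one, Matrix.mul_one, sub_self]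
    rfl
  · rw [act_pencil_nullVec_inr h]
    simp only [Matrix.mul_one, h.mul_P, hβ]
    simp

/-- The top components of a matrix of polynomials in the model. -/
theorem act_nullVec_inr (h : PencilSupport A R P) {ν : ℕ} (f : NCMat g ν ℓ) (i : Fin ν)
    (u : BoundedWord g N) (hf : ∀ j, f i j ∈ NCPoly.degLT g (u.1.length + 2)) :
    act (nullModel A R N β) f (nullVec A N) i (Sum.inr u) =
      ∑ a, ∑ j, NCPoly.coeff (u.1 ++ [a]) (f i j) * (P *ᵥ β a) j := by
  have h1 : ∀ j, (NCPoly.lift (nullModel A R N β) (f i j) *ᵥ nullVec A N j) (Sum.inr u) =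
      ∑ a, NCPoly.coeff (u.1 ++ [a]) (f i j) * (P *ᵥ β a) j := by
    intro j
    rw [nullModel, fockModel_poly_mulVec_inl _ (by simp [nullVec]) u (hf j)]
    simp only [dotProduct_nullVec h]
  simp only [act, Finset.sum_apply, h1]
  exact Finset.sum_comm

end NullModel

/-! ### Division by a monic pencil and the Nullstellensatz -/

section Nullstellensatz

variable {g ℓ ν : ℕ} {A : Fin g ⊕ Fin g → Matrix (Fin ℓ) (Fin ℓ) ℝ}
  {R P : Matrix (Fin ℓ) (Fin ℓ) ℝ}

/-- `f` maps the zeros of `L` to the zeros of `M`, for all symmetric actions of the letters. -/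
def MapsZeros {κ : ℕ} (L : NCMat g ℓ ℓ) (f : NCMat g ν ℓ) (M : NCMat g κ ν) : Prop :=
  ∀ (I : Type) [Fintype I] [DecidableEq I] (Y : Fin g ⊕ Fin g → Matrix I I ℝ),
    (∀ a, Y a.swap = (Y a)ᵀ) → ∀ v, act Y L v = 0 → act Y M (act Y f v) = 0

theorem mul_constMat_apply {κ : ℕ} (f : NCMat g κ ν) (C : Matrix (Fin ν) (Fin ℓ) ℝ) (i : Fin κ)
    (j : Fin ℓ) : (f * (constMat C : NCMat g ν ℓ)) i j = ∑ k, C k j • f i k := by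
  simp [Matrix.mul_apply, constMat, Algebra.algebraMap_eq_smul_one]

theorem constMat_mul_apply {κ : ℕ} (C : Matrix (Fin κ) (Fin ν) ℝ) (f : NCMat g ν ℓ) (i : Fin κ)
    (j : Fin ℓ) : ((constMat C : NCMat g κ ν) * f) i j = ∑ k, C i k • f k j := by
  simp [Matrix.mul_apply, constMat, Algebra.algebraMap_eq_smul_one]

theorem mul_constMat_mem_degLT {κ d : ℕ} {f : NCMat g κ ν} (C : Matrix (Fin ν) (Fin ℓ) ℝ)
    (hf : ∀ i j, f i j ∈ NCPoly.degLT g d) (i : Fin κ) (j : Fin ℓ) :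
    (f * (constMat C : NCMat g ν ℓ)) i j ∈ NCPoly.degLT g d := by
  rw [mul_constMat_apply]
  exact Submodule.sum_mem _ fun k _ => Submodule.smul_mem _ _ (hf i k)

theorem constMat_mul_mem_degLT {κ d : ℕ} (C : Matrix (Fin κ) (Fin ν) ℝ) {f : NCMat g ν ℓ}
    (hf : ∀ i j, f i j ∈ NCPoly.degLT g d) (i : Fin κ) (j : Fin ℓ) :
    ((constMat C : NCMat g κ ν) * f) i j ∈ NCPoly.degLT g d := by
  rw [constMat_mul_apply]
  exact Submodule.sum_mem _ fun k _ => Submodule.smul_mem _ _ (hf k j)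

theorem eq_constMat_of_degLT_one {κ : ℕ} {f : NCMat g κ ν}
    (hf : ∀ i j, f i j ∈ NCPoly.degLT g 1) :
    f = constMat (Matrix.of fun i j => NCPoly.coeff [] (f i j)) := by
  classical
  ext i j
  refine NCPoly.eq_of_coeff fun w => ?_
  have h1 : (algebraMap ℝ (NCPoly g)) (NCPoly.coeff [] (f i j)) =
      NCPoly.coeff [] (f i j) • NCPoly.word [] := by
    rw [NCPoly.word_nil, Algebra.algebraMap_eq_smul_one]
  simp only [constMat, Matrix.map_apply, Matrix.of_apply]
  rw [h1, map_smul, NCPoly.coeff_word]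
  split_ifs with h
  · simp [← h]
  · rw [smul_zero]
    refine hf i j w (Nat.one_le_iff_ne_zero.2 fun h0 => h ?_)
    exact (List.length_eq_zero_iff.1 h0).symm

/-- The columns of the projection onto the kernel of the coefficients of a pencil. -/
def kernelColumn (A : Fin g ⊕ Fin g → Matrix (Fin ℓ) (Fin ℓ) ℝ) (R : Matrix (Fin ℓ) (Fin ℓ) ℝ)
    (b a : Fin g ⊕ Fin g) : Matrix (Fin ℓ) (Fin ℓ) ℝ :=
  (if a = b then 1 else 0) - (A a)ᵀ * R * A b

/-- For the block row `T = (A_a)_a` one has `T Tᵀ = gram A`, and these are the blocks of the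
projection `1 - Tᵀ (T Tᵀ)⁺ T` onto the kernel of `T`. -/
theorem sum_mul_kernelColumn (h : PencilSupport A R P) (b : Fin g ⊕ Fin g) :
    ∑ a, A a * kernelColumn A R b a = 0 := by
  simp only [kernelColumn, Matrix.mul_sub, Finset.sum_sub_distrib, mul_ite, Matrix.mul_one,
    Matrix.mul_zero, Finset.sum_ite_eq', Finset.mem_univ, if_true, ← Matrix.mul_assoc]
  have : ∑ a, A a * (A a)ᵀ * R * A b = A b := by
    rw [← Matrix.sum_mul, ← Matrix.sum_mul]
    change gram A * R * A b = A b
    rw [h.gram_mul_R, h.P_mul]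
  rw [this, sub_self]

theorem sum_mulVec_kernelColumn (h : PencilSupport A R P) (b : Fin g ⊕ Fin g) (j : Fin ℓ) :
    ∑ a, A a *ᵥ (fun m => kernelColumn A R b a m j) = 0 := by
  funext i
  have := congrFun (congrFun (sum_mul_kernelColumn h b) i) j
  rw [Matrix.sum_apply] at this
  rw [Finset.sum_apply]
  exact this

/-- Division with remainder by a pencil, when the top components vanish in all models. -/
theorem exists_reduction (h : PencilSupport A R P) {d : ℕ} {f : NCMat g ν ℓ}
    (hf : ∀ i j, f i j ∈ NCPoly.degLT g (d + 2)) (hfP : f * (constMat P : NCMat g ℓ ℓ) = f)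
    (htop : ∀ β : Fin g ⊕ Fin g → Fin ℓ → ℝ, ∑ a, A a *ᵥ β a = 0 →
      ∀ u : List (Fin g ⊕ Fin g), u.length = d → ∀ i,
        ∑ a, ∑ j, NCPoly.coeff (u ++ [a]) (f i j) * (P *ᵥ β a) j = 0) :
    ∃ r : NCMat g ν ℓ, ∀ i j, (f - r * pencil A) i j ∈ NCPoly.degLT g (d + 1) := by
  have hdiv : ∀ a i j, (f.map (NCPoly.rightDiv a)) i j ∈ NCPoly.degLT g (d + 1) :=
    fun a i j => NCPoly.rightDiv_mem_degLT a (hf i j)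
  -- The least-squares quotient: writing `f_w` for the coefficient of a word `w`, the equations
  -- `f_{ub} = r_u A_b` have the candidate solution `r_u = ∑ f_{ua} A_aᵀ R`, which is exact once the
  -- leading coefficients annihilate the kernel of `(A_a)_a`.
  set r : NCMat g ν ℓ :=
    ∑ a, f.map (NCPoly.rightDiv a) * (constMat ((A a)ᵀ * R) : NCMat g ℓ ℓ) with hr
  have hrdeg : ∀ i j, r i j ∈ NCPoly.degLT g (d + 1) := by
    intro i j
    rw [hr, Matrix.sum_apply]
    exact Submodule.sum_mem _ fun a _ => mul_constMat_mem_degLT _ (hdiv a) i j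
  have hrcoeff : ∀ u i k, NCPoly.coeff u (r i k) =
      ∑ a, ∑ m, NCPoly.coeff (u ++ [a]) (f i m) * ((A a)ᵀ * R) m k := by
    intro u i k
    simp only [hr, Matrix.sum_apply, mul_constMat_apply, map_sum, map_smul, Matrix.map_apply,
      NCPoly.coeff_rightDiv, smul_eq_mul, mul_comm]
  refine ⟨r, fun i j => NCPoly.degLT_of_top ?_ fun w hw => ?_⟩
  · rw [Matrix.sub_apply, mul_pencil_apply]
    refine Submodule.sub_mem _ (hf i j) (Submodule.add_mem _ ?_ ?_)
    · exact NCPoly.degLT_mono (Nat.le_succ _) (hrdeg i j)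
    · exact Submodule.sum_mem _ fun a _ => Submodule.sum_mem _ fun k _ =>
        Submodule.smul_mem _ _ (NCPoly.mul_letter_mem_degLT a (hrdeg i k))
  · rcases List.eq_nil_or_concat' w with rfl | ⟨u, b, rfl⟩
    · simp at hw
    have hu : u.length = d := by simpa using hw
    have h1 : NCPoly.coeff (u ++ [b]) (r i j) = 0 := hrdeg i j _ hw.ge
    have h2 : NCPoly.coeff (u ++ [b]) (∑ a, ∑ k, A a k j • (r i k * NCPoly.letter a)) =
        ∑ k, A b k j * NCPoly.coeff u (r i k) := by
      simp only [map_sum, map_smul, NCPoly.coeff_mul_letter_append, smul_eq_mul, mul_ite, mul_zero]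
      rw [Finset.sum_comm]
      simp only [Finset.sum_ite_eq', Finset.mem_univ, if_true]
    rw [Matrix.sub_apply, mul_pencil_apply, map_sub, map_add, h1, h2, zero_add]
    have h3 := htop _ (sum_mulVec_kernelColumn h b j) u hu i
    -- The projection coming from the model is absorbed by `f`, as `f * P = f`.
    have h4 : ∀ a (x : Fin ℓ → ℝ), ∑ m, NCPoly.coeff (u ++ [a]) (f i m) * (P *ᵥ x) m =
        ∑ m, NCPoly.coeff (u ++ [a]) (f i m) * x m := by
      intro a x
      have h5 : ∀ m, NCPoly.coeff (u ++ [a]) (f i m) =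
          ∑ k, NCPoly.coeff (u ++ [a]) (f i k) * P k m := by
        intro m
        conv_lhs => rw [← hfP, mul_constMat_apply]
        simp only [map_sum, map_smul, smul_eq_mul, mul_comm]
      have h6 : ∀ m, NCPoly.coeff (u ++ [a]) (f i m) * x m =
          ∑ k, NCPoly.coeff (u ++ [a]) (f i k) * P k m * x m := fun m => by
        conv_lhs => rw [h5 m, Finset.sum_mul]
      rw [Finset.sum_congr rfl fun m _ => h6 m, Finset.sum_comm]
      simp only [Matrix.mulVec, dotProduct, Finset.mul_sum, mul_assoc]
    simp only [h4, kernelColumn, Matrix.sub_apply, mul_sub, Finset.sum_sub_distrib] at h3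
    have h6 : ∑ a, ∑ m, NCPoly.coeff (u ++ [a]) (f i m) *
        (if a = b then (1 : Matrix (Fin ℓ) (Fin ℓ) ℝ) else 0) m j =
        NCPoly.coeff (u ++ [b]) (f i j) := by
      rw [Finset.sum_eq_single b, Finset.sum_eq_single j]
      · simp
      · intro m _ hm
        simp [hm]
      · simp
      · intro a _ ha
        simp [ha]
      · simp
    rw [h6] at h3
    rw [← h3]
    congr 1
    simp only [hrcoeff, Finset.mul_sum]
    rw [Finset.sum_comm]
    refine Finset.sum_congr rfl fun a _ => ?_
    rw [Finset.sum_comm]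
    refine Finset.sum_congr rfl fun m _ => ?_
    rw [Matrix.mul_apply, Finset.mul_sum]
    refine Finset.sum_congr rfl fun k _ => ?_
    ring

theorem sub_mul_eq (h : PencilSupport A R P) (f : NCMat g ν ℓ) :
    f = f * (constMat P : NCMat g ℓ ℓ) + f * (constMat (1 - P) : NCMat g ℓ ℓ) * pencil A := by
  rw [Matrix.mul_assoc, h.one_sub_mul_pencil, ← Matrix.mul_add, constMat_sub, constMat_one,
    add_sub_cancel, Matrix.mul_one]

theorem act_one {I : Type} [Fintype I] [DecidableEq I] (Y : Fin g ⊕ Fin g → Matrix I I ℝ)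
    (v : Fin ν → I → ℝ) : act Y (1 : NCMat g ν ν) v = v := by
  funext i
  rw [← constMat_one, act_constMat]
  simp [Matrix.one_apply]

/-- Induction on the degree. After removing `f(1 - P)`, a left multiple of the pencil, evaluation at
the model gives the hypothesis of `exists_reduction`; the remainder still vanishes at all zeros. For
a constant `C`, the model vectors give `C * P = 0`. -/
theorem exists_eq_mul_pencil_aux (h : PencilSupport A R P) (d : ℕ) :
    ∀ f : NCMat g ν ℓ, (∀ i j, f i j ∈ NCPoly.degLT g (d + 1)) →
      MapsZeros (pencil A) f (1 : NCMat g ν ν) → ∃ r : NCMat g ν ℓ, f = r * pencil A := by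
  induction d with
  | zero =>
    intro f hf hz
    set C := Matrix.of fun i j => NCPoly.coeff [] (f i j) with hC
    have hfC : f = constMat C := eq_constMat_of_degLT_one hf
    have h1 := hz _ (nullModel A R 0 0) (nullModel_swap h 0 0) _
      (act_pencil_nullVec h (by simp))
    rw [act_one] at h1
    have h2 : stacked A * Cᵀ = 0 := by
      ext x i
      have h3 := congrFun (congrFun h1 i) (Sum.inl x)
      rw [hfC, act_constMat] at h3
      simp only [Finset.sum_apply, Pi.smul_apply, smul_eq_mul, nullVec, Sum.elim_inl,
        Pi.zero_apply] at h3
      rw [Matrix.mul_apply, ← h3.trans (Matrix.zero_apply x i).symm]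
      exact Finset.sum_congr rfl fun j _ => mul_comm _ _
    have h3 : P * Cᵀ = 0 := by
      rw [← h.R_mul_gram, ← stacked_transpose_mul, Matrix.mul_assoc, Matrix.mul_assoc, h2,
        Matrix.mul_zero, Matrix.mul_zero]
    have h4 : C * P = 0 := by
      have := congrArg Matrix.transpose h3
      rwa [Matrix.transpose_mul, h.transpose_P, Matrix.transpose_transpose,
        Matrix.transpose_zero] at this
    refine ⟨f * (constMat (1 - P) : NCMat g ℓ ℓ), ?_⟩
    conv_lhs => rw [sub_mul_eq h f]
    have : f * (constMat P : NCMat g ℓ ℓ) = 0 := by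
      rw [hfC, ← constMat_mul, h4]
      ext
      simp [constMat]
    rw [this, zero_add]
  | succ d ih =>
    intro f hf hz
    have hPP : f * (constMat P : NCMat g ℓ ℓ) * (constMat P : NCMat g ℓ ℓ) = f * (constMat P : NCMat g ℓ ℓ) := by
      rw [Matrix.mul_assoc, ← constMat_mul, h.P_mul_P]
    have hfP : f * (constMat P : NCMat g ℓ ℓ) =
        f - f * (constMat (1 - P) : NCMat g ℓ ℓ) * pencil A :=
      eq_sub_of_add_eq (sub_mul_eq h f).symm
    have hdeg := mul_constMat_mem_degLT P hf
    obtain ⟨r, hr⟩ := exists_reduction h hdeg hPP (by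
      intro β hβ u hu i
      have h1 := hz _ (nullModel A R d β) (nullModel_swap h d β) _ (act_pencil_nullVec h hβ)
      rw [act_one] at h1
      have h2 : act (nullModel A R d β) (f * (constMat P : NCMat g ℓ ℓ)) (nullVec A d) = 0 := by
        rw [hfP, act_sub, act_mul _ _ (pencil A), act_pencil_nullVec h hβ, act_zero, h1, sub_zero]
      rw [← act_nullVec_inr h _ i ⟨u, hu.le⟩ fun j => ?_, h2]
      · rfl
      · rw [hu]
        exact hdeg i j)
    obtain ⟨s, hs⟩ := ih _ hr (by
      intro I _ _ Y hY v hv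
      have h1 := hz I Y hY v hv
      rw [act_one] at h1
      rw [act_one, hfP, sub_sub, ← Matrix.add_mul, act_sub, act_mul, hv, act_zero, h1, sub_zero])
    refine ⟨s + r + f * (constMat (1 - P) : NCMat g ℓ ℓ), ?_⟩
    rw [Matrix.add_mul, Matrix.add_mul, ← hs]
    conv_lhs => rw [sub_mul_eq h f]
    rw [sub_add_cancel]

/-- **Nullstellensatz for a monic pencil.** A polynomial that vanishes at all zeros of the pencil
is a left multiple of the pencil. -/
theorem exists_eq_mul_pencil (h : PencilSupport A R P) {f : NCMat g ν ℓ}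
    (hz : MapsZeros (pencil A) f (1 : NCMat g ν ν)) : ∃ r : NCMat g ν ℓ, f = r * pencil A := by
  obtain ⟨d, hd⟩ := NCPoly.exists_forall_mem_degLT fun ij : Fin ν × Fin ℓ => f ij.1 ij.2
  exact exists_eq_mul_pencil_aux h d f
    (fun i j => NCPoly.degLT_mono (Nat.le_succ d) (hd (i, j))) hz

end Nullstellensatz

/-! ### Matrices of polynomials that preserve the zeros of a pencil -/

section Commutant

variable {g ℓ : ℕ} {A : Fin g ⊕ Fin g → Matrix (Fin ℓ) (Fin ℓ) ℝ}
  {R P : Matrix (Fin ℓ) (Fin ℓ) ℝ}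

/-- Constant matrices preserving the zeros of a pencil commute with it. -/
theorem comm_of_mapsZeros_constMat (h : PencilSupport A R P) {C : Matrix (Fin ℓ) (Fin ℓ) ℝ}
    (hCP : C * P = C) (hz : MapsZeros (pencil A) (constMat C : NCMat g ℓ ℓ) (pencil A))
    (b : Fin g ⊕ Fin g) : A b * C = C * A b := by
  have hact : ∀ β : Fin g ⊕ Fin g → Fin ℓ → ℝ, ∑ a, A a *ᵥ β a = 0 →
      act (nullModel A R 0 β) (pencil A) (fun j => ∑ k, C j k • nullVec A 0 k) = 0 := by
    intro β hβ
    have := hz _ (nullModel A R 0 β) (nullModel_swap h 0 β) _ (act_pencil_nullVec h hβ)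
    rwa [show act (nullModel A R 0 β) (constMat C : NCMat g ℓ ℓ) (nullVec A 0) =
      fun j => ∑ k, C j k • nullVec A 0 k from funext fun j => act_constMat _ _ _ _] at this
  set K := ∑ a, A a * C * (A a)ᵀ with hK
  have hKT : Kᵀ = ∑ a, A a * Cᵀ * (A a)ᵀ := by
    rw [hK, Matrix.transpose_sum]
    exact Finset.sum_congr rfl fun a _ => by
      simp [Matrix.transpose_mul, Matrix.mul_assoc]
  -- The vacuum components say that `(A_a C)_a` annihilates the kernel of `(A_a)_a`; testing on the
  -- kernel columns gives the identity.
  have h1 : A b * C = K * R * A b := by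
    have h2 : ∀ j, (∑ a, A a * C * kernelColumn A R b a).col j = 0 := by
      intro j
      have h3 := hact _ (sum_mulVec_kernelColumn h b j)
      funext i
      have h4 := congrFun (congrFun h3 i) (Sum.inr ⟨[], by simp⟩)
      rw [act_pencil_nullVec_inr h] at h4
      simp only [vacuum, if_true, one_mul, Matrix.mul_assoc, hCP] at h4
      rw [Matrix.col_apply, Matrix.sum_apply]
      simp only [Matrix.mul_assoc]
      rw [Finset.sum_apply] at h4
      refine Eq.trans (Finset.sum_congr rfl fun a _ => ?_) h4
      rw [← Matrix.mul_assoc]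
      rfl
    have h5 : ∑ a, A a * C * kernelColumn A R b a = 0 := by
      ext i j
      exact congrFun (h2 j) i
    simp only [kernelColumn, Matrix.mul_sub, Finset.sum_sub_distrib, mul_ite, Matrix.mul_one,
      Matrix.mul_zero, Finset.sum_ite_eq', Finset.mem_univ, if_true, sub_eq_zero] at h5
    rw [h5, hK, Matrix.sum_mul, Matrix.sum_mul]
    simp only [Matrix.mul_assoc]
  -- The `ℝ^H` components, already at `β = 0`, identify `C` with `K * R * P`. Inserting `P` before
  -- `A b` in `h1` then yields commutation.
  have h6 : stacked A * (Cᵀ - R * Kᵀ) = 0 := by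
    ext x i
    have h7 := congrFun (congrFun (hact 0 (by simp)) i) (Sum.inl x)
    rw [act_pencil_nullVec_inl C i x h, ← hKT] at h7
    exact h7
  have h8 : P * (Cᵀ - R * Kᵀ) = 0 := by
    rw [← h.R_mul_gram, ← stacked_transpose_mul, Matrix.mul_assoc, Matrix.mul_assoc, h6,
      Matrix.mul_zero, Matrix.mul_zero]
  have h9 : (C - K * R) * P = 0 := by
    have := congrArg Matrix.transpose h8
    rwa [Matrix.transpose_mul, Matrix.transpose_sub, Matrix.transpose_mul, h.transpose_P,
      h.transpose_R, Matrix.transpose_transpose, Matrix.transpose_transpose,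
      Matrix.transpose_zero] at this
  rw [Matrix.sub_mul, sub_eq_zero, hCP] at h9
  rw [h1, h9, Matrix.mul_assoc _ P, h.P_mul]

/-- Let `τ` be the component at `u` of `U` applied to the model zero. Applying the pencil once more
produces the component `A_c τ` at `c :: u`, where nothing else contributes. So every `A_c` kills
`τ`, while `P τ = τ`, and therefore `τ = 0`. -/
theorem top_component_eq_zero (h : PencilSupport A R P) {d : ℕ} {U : NCMat g ℓ ℓ}
    (hU : ∀ i j, U i j ∈ NCPoly.degLT g (d + 2))
    (hPU : (constMat P : NCMat g ℓ ℓ) * U = U) (hz : MapsZeros (pencil A) U (pencil A))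
    {β : Fin g ⊕ Fin g → Fin ℓ → ℝ} (hβ : ∑ a, A a *ᵥ β a = 0)
    (u : List (Fin g ⊕ Fin g)) (hu : u.length = d) (i : Fin ℓ) :
    ∑ a, ∑ j, NCPoly.coeff (u ++ [a]) (U i j) * (P *ᵥ β a) j = 0 := by
  set τ : Fin ℓ → ℝ := fun i => ∑ a, ∑ j, NCPoly.coeff (u ++ [a]) (U i j) * (P *ᵥ β a) j with hτ
  have hPτ : P *ᵥ τ = τ := by
    funext i
    conv_rhs => rw [hτ]
    have h1 : ∀ a j, NCPoly.coeff (u ++ [a]) (U i j) =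
        ∑ k, P i k * NCPoly.coeff (u ++ [a]) (U k j) := fun a j => by
      conv_lhs => rw [← hPU, constMat_mul_apply]
      simp only [map_sum, map_smul, smul_eq_mul]
    have h2 : ∀ a j, NCPoly.coeff (u ++ [a]) (U i j) * (P *ᵥ β a) j =
        ∑ k, P i k * (NCPoly.coeff (u ++ [a]) (U k j) * (P *ᵥ β a) j) := fun a j => by
      rw [h1, Finset.sum_mul]
      simp only [mul_assoc]
    simp only [Matrix.mulVec, dotProduct] at h2 ⊢
    simp only [h2]
    simp only [hτ, Finset.mul_sum, Matrix.mulVec, dotProduct]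
    rw [Finset.sum_comm]
    refine Finset.sum_congr rfl fun a _ => ?_
    rw [Finset.sum_comm]
  have hAτ : ∀ c, A c *ᵥ τ = 0 := by
    intro c
    -- Truncation at `d + 1`, one above the length of `u`, leaves room for the word `c :: u`.
    have hv := act_pencil_nullVec (N := d + 1) h hβ
    have hact := hz _ (nullModel A R (d + 1) β) (nullModel_swap h (d + 1) β) _ hv
    set w := act (nullModel A R (d + 1) β) U (nullVec A (d + 1)) with hw
    have hwlong : ∀ j (x : BoundedWord g (d + 1)), d < x.1.length → w j (Sum.inr x) = 0 := by
      intro j x hx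
      rw [hw, act_nullVec_inr h U j x fun k => NCPoly.degLT_mono (by omega) (hU j k)]
      refine Finset.sum_eq_zero fun a _ => Finset.sum_eq_zero fun k _ => ?_
      rw [hU j k _ (by simp; omega), zero_mul]
    have hwu : ∀ j, w j (Sum.inr ⟨u, by omega⟩) = τ j := fun j =>
      act_nullVec_inr h U j ⟨u, by omega⟩ fun k => by simpa [hu] using hU j k
    funext i
    have h1 := congrFun (congrFun hact i) (Sum.inr ⟨c :: u, by simp [hu]⟩)
    rw [act_pencil] at h1
    simp only [Pi.add_apply, Finset.sum_apply, Pi.smul_apply, smul_eq_mul] at h1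
    rw [hwlong i ⟨c :: u, _⟩ (by simp [hu]), zero_add, Finset.sum_eq_single c] at h1
    · simp only [Matrix.mulVec, dotProduct]
      refine Eq.trans (Finset.sum_congr rfl fun j _ => ?_) h1
      rw [nullModel, fockModel_mulVec_cons _ _ _ _ _ fun x hx => hwlong j x (by omega)]
      rw [if_pos rfl, hwu]
    · intro a _ ha
      refine Finset.sum_eq_zero fun j _ => ?_
      rw [nullModel, fockModel_mulVec_cons _ _ _ _ _ fun x hx => hwlong j x (by omega),
        if_neg ha.symm, mul_zero]
    · simp
  have : τ = 0 := by
    rw [← hPτ, ← h.R_mul_gram, ← Matrix.mulVec_mulVec, gram, Matrix.sum_mulVec]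
    rw [Finset.sum_eq_zero, Matrix.mulVec_zero]
    intro a _
    rw [← Matrix.mulVec_mulVec, ← h.swap, hAτ, Matrix.mulVec_zero]
  exact congrFun this i

/-- The leading part is divided off while the degree is positive; subtracting a left multiple of the
pencil does not affect preservation of zeros. The surviving constant commutes with the coefficients
by `comm_of_mapsZeros_constMat`. -/
theorem exists_eq_mul_pencil_add_constMat_aux (h : PencilSupport A R P) (d : ℕ) :
    ∀ U : NCMat g ℓ ℓ, (∀ i j, U i j ∈ NCPoly.degLT g (d + 1)) →
      (constMat P : NCMat g ℓ ℓ) * U = U → U * (constMat P : NCMat g ℓ ℓ) = U →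
      MapsZeros (pencil A) U (pencil A) →
      ∃ (r : NCMat g ℓ ℓ) (C : Matrix (Fin ℓ) (Fin ℓ) ℝ), (∀ a, A a * C = C * A a) ∧
        U = r * pencil A + constMat C := by
  induction d with
  | zero =>
    intro U hU _ hUP hz
    set C := Matrix.of fun i j => NCPoly.coeff [] (U i j)
    have hUC : U = constMat C := eq_constMat_of_degLT_one hU
    have hUCP : U = constMat (C * P) := by rw [constMat_mul, ← hUC, hUP]
    refine ⟨0, C * P, fun a => comm_of_mapsZeros_constMat h ?_ ?_ a, ?_⟩
    · rw [Matrix.mul_assoc, h.P_mul_P]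
    · rwa [← hUCP]
    · rw [Matrix.zero_mul, zero_add, ← hUCP]
  | succ d ih =>
    intro U hU hPU hUP hz
    obtain ⟨r, hr⟩ := exists_reduction h hU hUP
      (fun β hβ u hu i => top_component_eq_zero h hU hPU hz hβ u hu i)
    -- Compressing the quotient by `P` on both sides keeps the remainder supported on `P`, as the
    -- induction requires; `P` commutes with the pencil.
    let r' : NCMat g ℓ ℓ := (constMat P : NCMat g ℓ ℓ) * r * (constMat P : NCMat g ℓ ℓ)
    have hr' : U - r' * pencil A =
        (constMat P : NCMat g ℓ ℓ) * (U - r * pencil A) * (constMat P : NCMat g ℓ ℓ) := by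
      rw [Matrix.mul_sub, Matrix.sub_mul, hPU, hUP, Matrix.mul_assoc _ (constMat P) (pencil A),
        h.constMat_comm]
      simp only [Matrix.mul_assoc]
    have hPPc : (constMat P : NCMat g ℓ ℓ) * (constMat P : NCMat g ℓ ℓ) = constMat P := by
      rw [← constMat_mul, h.P_mul_P]
    obtain ⟨s, C, hC, hs⟩ := ih (U - r' * pencil A)
      (by
        rw [hr']
        exact mul_constMat_mem_degLT _ (constMat_mul_mem_degLT _ hr))
      (by
        rw [hr', ← Matrix.mul_assoc, ← Matrix.mul_assoc, hPPc])
      (by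
        rw [hr', Matrix.mul_assoc _ (constMat P) (constMat P), hPPc])
      (by
        intro I _ _ Y hY v hv
        have h1 := hz I Y hY v hv
        rw [act_sub, act_mul, hv, act_zero, sub_zero, h1])
    refine ⟨s + r', C, hC, ?_⟩
    rw [Matrix.add_mul, add_right_comm, ← hs, sub_add_cancel]

/-- Matrices of polynomials preserving the zeros of a pencil are, modulo left multiples of the
pencil, constant matrices commuting with it. -/
theorem exists_eq_mul_pencil_add_constMat (h : PencilSupport A R P) {U : NCMat g ℓ ℓ}
    (hz : MapsZeros (pencil A) U (pencil A)) :
    ∃ (r : NCMat g ℓ ℓ) (C : Matrix (Fin ℓ) (Fin ℓ) ℝ), (∀ a, A a * C = C * A a) ∧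
      U = r * pencil A + constMat C := by
  -- Because `1 - P = (1 - P)L`, the product `(1 - P)U = (1 - P)LU` vanishes at all zeros of the
  -- pencil, and the Nullstellensatz applies.
  obtain ⟨s, hs⟩ : ∃ s : NCMat g ℓ ℓ, (constMat (1 - P) : NCMat g ℓ ℓ) * U = s * pencil A := by
    refine exists_eq_mul_pencil h fun I _ _ Y hY v hv => ?_
    rw [act_one, ← h.one_sub_mul_pencil, act_mul, act_mul, hz I Y hY v hv, act_zero]
  have hU1 : U = (constMat P : NCMat g ℓ ℓ) * U + s * pencil A := by
    rw [← hs, ← Matrix.add_mul, constMat_sub, constMat_one, add_sub_cancel, Matrix.one_mul]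
  set W := (constMat P : NCMat g ℓ ℓ) * U * (constMat P : NCMat g ℓ ℓ) with hW
  set t := (constMat P : NCMat g ℓ ℓ) * U * (constMat (1 - P) : NCMat g ℓ ℓ) with ht
  have hU2 : U = W + (t + s) * pencil A := by
    conv_lhs => rw [hU1, sub_mul_eq h ((constMat P : NCMat g ℓ ℓ) * U)]
    rw [Matrix.add_mul, add_assoc]
  have hPPc : (constMat P : NCMat g ℓ ℓ) * (constMat P : NCMat g ℓ ℓ) = constMat P := by
    rw [← constMat_mul, h.P_mul_P]
  obtain ⟨d, hd⟩ := NCPoly.exists_forall_mem_degLT fun ij : Fin ℓ × Fin ℓ => W ij.1 ij.2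
  obtain ⟨r, C, hC, hrC⟩ := exists_eq_mul_pencil_add_constMat_aux h d W
    (fun i j => NCPoly.degLT_mono (Nat.le_succ d) (hd (i, j)))
    (by rw [hW, ← Matrix.mul_assoc, ← Matrix.mul_assoc, hPPc])
    (by rw [hW, Matrix.mul_assoc _ (constMat P) (constMat P), hPPc])
    (by
      intro I _ _ Y hY v hv
      have h1 := hz I Y hY v hv
      rw [hU2, act_add, act_mul Y (t + s), hv, act_zero, add_zero] at h1
      exact h1)
  refine ⟨r + (t + s), C, hC, ?_⟩
  rw [Matrix.add_mul, add_right_comm, ← hrC, ← hU2]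

end Commutant

/-! ### The boundary of the pencil and the Randstellensatz -/

section Main

variable {g ℓ : ℕ} {A : Fin g ⊕ Fin g → Matrix (Fin ℓ) (Fin ℓ) ℝ}

/-- The pencil is symmetric at every tuple, so positivity reduces to non-strict inequalities
continuous in `X`. Hence `L(X) ⪰ 0` persists on the closure of the principal component. -/
theorem isClosed_posDomain_pencil (hA : ∀ a, A a.swap = (A a)ᵀ) (n : ℕ) :
    IsClosed (posDomain (pencil A) n) := by
  have hcont : Continuous fun X : MatTuple g n => evalMat (pencil A) X := by
    refine continuous_pi fun ik => continuous_pi fun jm => ?_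
    have h1 : ∀ a : Fin g ⊕ Fin g, Continuous fun X : MatTuple g n =>
        evalPoly X (NCPoly.letter a) ik.2 jm.2 := by
      rintro (i | i)
      · simp only [evalPoly_letter, Sum.elim_inl]
        exact (continuous_apply i).matrix_elem _ _
      · simp only [evalPoly_letter, Sum.elim_inr, Matrix.transpose_apply]
        exact (continuous_apply i).matrix_elem _ _
    have h2 : (fun X : MatTuple g n => evalMat (pencil A) X ik jm) = fun X =>
        (1 : Matrix (Fin ℓ) (Fin ℓ) ℝ) ik.1 jm.1 * (1 : Matrix (Fin n) (Fin n) ℝ) ik.2 jm.2 +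
          ∑ a, A a ik.1 jm.1 * evalPoly X (NCPoly.letter a) ik.2 jm.2 := by
      funext X
      rw [show evalMat (pencil A) X ik jm = evalPoly X (pencil A ik.1 jm.1) ik.2 jm.2 from rfl,
        pencil_apply]
      simp only [map_add, map_sum, map_smul, map_one, Matrix.add_apply, Matrix.smul_apply,
        Matrix.sum_apply, smul_eq_mul]
    rw [h2]
    exact continuous_const.add (continuous_finsetSum _ fun a _ => continuous_const.mul (h1 a))
  have hset : posDomain (pencil A) n =
      {X | ∀ z, 0 ≤ star z ⬝ᵥ (evalMat (pencil A) X *ᵥ z)} := by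
    ext X
    refine ⟨fun h => h.dotProduct_mulVec_nonneg, fun h => .of_dotProduct_mulVec_nonneg ?_ h⟩
    rw [Matrix.IsHermitian, Matrix.conjTranspose_eq_transpose_of_trivial]
    exact evalMat_pencil_transpose A hA X
  rw [hset, Set.ofPred_forall]
  exact isClosed_iInter fun z => isClosed_le continuous_const
    (continuous_const.dotProduct (hcont.matrix_mulVec continuous_const))

theorem closure_principalComponent_subset (hA : ∀ a, A a.swap = (A a)ᵀ) (n : ℕ) :
    closure (principalComponent (pencil A) n) ⊆ posDomain (pencil A) n :=
  closure_minimal (fun _ hX => (connectedComponentIn_subset _ _ hX).posSemidef)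
    (isClosed_posDomain_pencil hA n)

theorem HasRandRepresentation.posDomain_subset (hA : ∀ a, A a.swap = (A a)ᵀ) {p : NCMat g ℓ ℓ}
    (hp : HasRandRepresentation (pencil A) p) (n : ℕ) :
    posDomain (pencil A) n ⊆ posDomain p n := by
  obtain ⟨M, N, q, r, C, -, rfl⟩ := hp
  intro X hX
  change (evalMat _ X).PosSemidef
  rw [evalMat_add, evalMat_mul, evalMat_mul, evalMat_sum, evalMat_sum]
  refine Matrix.PosSemidef.add ?_ (Matrix.posSemidef_sum _ fun j _ => ?_)
  · have h1 : (∑ i, evalMat ((q i)ᴴ * q i) X).PosSemidef := by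
      refine Matrix.posSemidef_sum _ fun i _ => ?_
      rw [evalMat_mul, evalMat_conjTranspose, ← Matrix.conjTranspose_eq_transpose_of_trivial]
      exact Matrix.posSemidef_conjTranspose_mul_self _
    have h2 := h1.conjTranspose_mul_mul_same (evalMat (pencil A) X)
    rwa [Matrix.conjTranspose_eq_transpose_of_trivial, evalMat_pencil_transpose A hA] at h2
  · rw [evalMat_mul, evalMat_mul, evalMat_conjTranspose,
      ← Matrix.conjTranspose_eq_transpose_of_trivial]
    exact Matrix.PosSemidef.conjTranspose_mul_mul_same hX _

/-- Commutation moves `L` to the right: `L(rL + C) = (Lr + C)L`. Every term thus ends in a factor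
`L`. -/
theorem HasRandRepresentation.matZeroSet_subset {L p : NCMat g ℓ ℓ}
    (hp : HasRandRepresentation L p) (n : ℕ) : matZeroSet L n ⊆ matZeroSet p n := by
  obtain ⟨M, N, q, r, C, hC, rfl⟩ := hp
  rintro ⟨X, v⟩ hv
  change evalMat L X *ᵥ v = 0 at hv
  change evalMat _ X *ᵥ v = 0
  rw [evalMat_add, evalMat_sum, Matrix.add_mulVec, evalMat_mul, ← Matrix.mulVec_mulVec, hv,
    Matrix.mulVec_zero, zero_add, Matrix.sum_mulVec]
  refine Finset.sum_eq_zero fun j _ => ?_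
  rw [Matrix.mul_assoc, Matrix.mul_add, ← hC, ← Matrix.mul_assoc L, ← Matrix.add_mul,
    ← Matrix.mul_assoc, evalMat_mul, ← Matrix.mulVec_mulVec, hv, Matrix.mulVec_zero]

theorem mapsZeros_of_matZeroSet_subset {ν κ : ℕ} {L : NCMat g ℓ ℓ} {f : NCMat g ν ℓ}
    {M : NCMat g κ ν} (h : ∀ n, matZeroSet L n ⊆ matZeroSet (M * f) n) : MapsZeros L f M := by
  intro I _ _ Y hY v hv
  rw [← act_mul]
  exact act_eq_zero_of_matZeroSet_subset h hY hv

/-- The zero determining property concerns single rows; it is applied to each row of `f` separately.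
-/
theorem ZeroDetermining.matZeroSet_subset {L : NCMat g ℓ ℓ} (hZ : ZeroDetermining L) {ν : ℕ}
    {f : NCMat g ν ℓ} (hf : ∀ n, detailedBoundary L n ⊆ matZeroSet f n) (n : ℕ) :
    matZeroSet L n ⊆ matZeroSet f n := by
  have hrow : ∀ (i : Fin ν) {n : ℕ} (X : MatTuple g n) (v : Fin ℓ × Fin n → ℝ) (j : Fin 1)
      (k : Fin n), (evalMat (rowAt f i) X *ᵥ v) (j, k) = (evalMat f X *ᵥ v) (i, k) :=
    fun _ _ _ _ _ _ => rfl
  rintro ⟨X, v⟩ hv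
  rw [← hZ] at hv
  funext ⟨i, k⟩
  have h1 : rowAt f i ∈ vanishingModule (detailedBoundary L) := by
    rintro m ⟨Y, w⟩ hw
    funext ⟨j, k⟩
    rw [hrow]
    exact congrFun (hf m hw) (i, k)
  have h2 := congrFun (hv _ h1) (0, k)
  rwa [hrow] at h2

/-- The terms of a quadratic module representation vanish where the sum does. -/
theorem terms_vanish {n N : ℕ} {L : NCMat g ℓ ℓ} {q : Fin N → NCMat g 1 ℓ}
    {U : Fin N → NCMat g ℓ ℓ} {X : MatTuple g n} (hX : (evalMat L X).PosSemidef)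
    {v : Fin ℓ × Fin n → ℝ}
    (hv : evalMat (∑ i, ((q i)ᴴ * q i + (U i)ᴴ * L * U i)) X *ᵥ v = 0) (i : Fin N) :
    evalMat (q i) X *ᵥ v = 0 ∧ evalMat (L * U i) X *ᵥ v = 0 := by
  have hterm : ∀ i, v ⬝ᵥ (evalMat ((q i)ᴴ * q i + (U i)ᴴ * L * U i) X *ᵥ v) =
      (evalMat (q i) X *ᵥ v) ⬝ᵥ (evalMat (q i) X *ᵥ v) +
      star (evalMat (U i) X *ᵥ v) ⬝ᵥ (evalMat L X *ᵥ (evalMat (U i) X *ᵥ v)) := by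
    intro i
    rw [evalMat_add, evalMat_mul, evalMat_mul, evalMat_mul, evalMat_conjTranspose,
      evalMat_conjTranspose, Matrix.add_mulVec, dotProduct_add, Matrix.mul_assoc,
      ← Matrix.mulVec_mulVec, ← Matrix.mulVec_mulVec, ← Matrix.mulVec_mulVec, star_trivial,
      Matrix.dotProduct_mulVec, Matrix.vecMul_transpose, Matrix.dotProduct_mulVec v,
      Matrix.vecMul_transpose]
  have hnn : ∀ i, 0 ≤ (evalMat (q i) X *ᵥ v) ⬝ᵥ (evalMat (q i) X *ᵥ v) := fun i => by
    simpa using dotProduct_star_self_nonneg (evalMat (q i) X *ᵥ v)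
  have hnn' : ∀ i, 0 ≤ star (evalMat (U i) X *ᵥ v) ⬝ᵥ
      (evalMat L X *ᵥ (evalMat (U i) X *ᵥ v)) := fun i => hX.dotProduct_mulVec_nonneg _
  have hsum : ∑ i, v ⬝ᵥ (evalMat ((q i)ᴴ * q i + (U i)ᴴ * L * U i) X *ᵥ v) = 0 := by
    rw [evalMat_sum, Matrix.sum_mulVec] at hv
    rw [← dotProduct_sum, hv, dotProduct_zero]
  simp only [hterm] at hsum
  have h1 := (Finset.sum_eq_zero_iff_of_nonneg fun i _ => add_nonneg (hnn i) (hnn' i)).1 hsum i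
    (Finset.mem_univ i)
  have h2 := (add_eq_zero_iff_of_nonneg (hnn i) (hnn' i)).1 h1
  refine ⟨dotProduct_self_eq_zero.1 h2.1, ?_⟩
  rw [evalMat_mul, ← Matrix.mulVec_mulVec]
  -- Semidefiniteness gives only `L U v = 0`, not `U v = 0`; this is where the constants `C_j` of
  -- the representation originate.
  exact (hX.dotProduct_mulVec_zero_iff _).1 h2.2

theorem hasRandRepresentation_of_subset (hA : ∀ a, A a.swap = (A a)ᵀ)
    (hZ : ZeroDetermining (pencil A)) {p : NCMat g ℓ ℓ}
    (hpos : ∀ n, posDomain (pencil A) n ⊆ posDomain p n)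
    (hbd : ∀ n, detailedBoundary (pencil A) n ⊆ matZeroSet p n) :
    HasRandRepresentation (pencil A) p := by
  obtain ⟨R, P, h⟩ := exists_pencilSupport hA
  obtain ⟨N, q, U, rfl⟩ := exists_sum_of_squares hA hpos
  have hvan : ∀ i n, ∀ Xv ∈ detailedBoundary (pencil A) n,
      evalMat (q i) Xv.1 *ᵥ Xv.2 = 0 ∧ evalMat (pencil A * U i) Xv.1 *ᵥ Xv.2 = 0 :=
    fun i n Xv hXv => terms_vanish (closure_principalComponent_subset hA n hXv.1) (hbd n hXv) i
  have hq : ∀ i, ∃ a : NCMat g 1 ℓ, q i = a * pencil A := fun i =>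
    exists_eq_mul_pencil h (mapsZeros_of_matZeroSet_subset (by
      rw [Matrix.one_mul]
      exact hZ.matZeroSet_subset fun n Xv hXv => (hvan i n Xv hXv).1))
  have hU : ∀ i, ∃ (r : NCMat g ℓ ℓ) (C : Matrix (Fin ℓ) (Fin ℓ) ℝ),
      (∀ a, A a * C = C * A a) ∧ U i = r * pencil A + constMat C := fun i =>
    exists_eq_mul_pencil_add_constMat h (mapsZeros_of_matZeroSet_subset
      (hZ.matZeroSet_subset fun n Xv hXv => (hvan i n Xv hXv).2))
  choose a ha using hq
  choose r C hC hrC using hU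
  refine ⟨N, N, a, r, C, fun j => constMat_comm_pencil A (hC j), ?_⟩
  rw [Finset.sum_add_distrib, Matrix.mul_sum, Matrix.sum_mul]
  congr 1
  · refine Finset.sum_congr rfl fun i _ => ?_
    rw [ha i, Matrix.conjTranspose_mul, pencil_conjTranspose A hA]
    simp only [Matrix.mul_assoc]
  · exact Finset.sum_congr rfl fun i _ => by rw [hrC i]

end Main

theorem theorem1p1 {g ℓ : ℕ} (L : NCMat g ℓ ℓ) (hL : IsMonicLinearPencil L)
    (hZ : ZeroDetermining L) (p : NCMat g ℓ ℓ) :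
    (((∀ n, posDomain L n ⊆ posDomain p n) ∧
        (∀ n, detailedBoundary L n ⊆ matZeroSet p n)) ↔
      HasRandRepresentation L p) ∧
    (((∀ n, posDomain L n ⊆ posDomain p n) ∧
        (∀ n, detailedBoundary L n ⊆ detailedBoundary p n)) ↔
      (HasRandRepresentation L p ∧
        ∀ n, principalComponent L n ⊆ closure (principalComponent p n))) := by
  obtain ⟨A, hA, rfl⟩ := hL.exists_eq_pencil
  have hbd : HasRandRepresentation (pencil A) p →
      ∀ n, detailedBoundary (pencil A) n ⊆ matZeroSet p n :=
    fun hp n Xv hXv => hp.matZeroSet_subset n hXv.2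
  refine ⟨⟨fun h => hasRandRepresentation_of_subset hA hZ h.1 h.2,
    fun hp => ⟨hp.posDomain_subset hA, hbd hp⟩⟩, ⟨fun h => ⟨?_, fun n X hX => ?_⟩, fun h => ?_⟩⟩
  · exact hasRandRepresentation_of_subset hA hZ h.1 fun n Xv hXv => (h.2 n hXv).2
  · have h0 : (X, (0 : Fin ℓ × Fin n → ℝ)) ∈ detailedBoundary (pencil A) n :=
      ⟨subset_closure hX, Matrix.mulVec_zero _⟩
    exact (h.2 n h0).1
  · exact ⟨h.1.posDomain_subset hA, fun n Xv hXv =>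
      ⟨closure_minimal (h.2 n) isClosed_closure hXv.1, hbd h.1 n hXv⟩⟩
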